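/- Let $d\ge 1$, $\Omega=[0,2\pi]^d$, $0<V_{\min}\le V_{\max}$, $\kappa_1,\kappa_2\in\mathbb R$ and $c_0>0$. All functions are complex-valued unless said otherwise, $(v,w)=\int_\Omega v\bar w$, $\|\cdot\|$ is the $L^2(\Omega)$ norm, and $H^1_P(\Omega)$ is the space of $w\in H^1(\Omega)$ that are periodic on $\partial\Omega$ (traces on opposite sides agree). For $\varepsilon>0$ and a measurable real potential $V$ with $V_{\min}\le V\le V_{\max}$ on $\Omega$ put $$a(v,w)=\tfrac{\varepsilon^2}{2}(\nabla v,\nabla w)+(Vv,w),\qquad \|w\|_e=a(w,w)^{1/2}.$$ Let $\mathcal T_H$ be a conforming simplicial mesh of $\Omega$, compatible with the periodic boundary conditions (the triangulations of opposite sides of $\Omega$ are translates of each other), with mesh size $H=\max_T\operatorname{diam}T$. Assume that it is shape regular (each element $T$ contains a ball of some radius $\rho_T>0$ with $\operatorname{diam}T\le\kappa_1\rho_T$) and quasi-uniform ($H\le\kappa_2\operatorname{diam}T$ for each element $T$). Let $\phi_1,\dots,\phi_{N_H}$ be the nodal basis of the continuous periodic piecewise affine functions on $\mathcal T_H$, where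 vertices that differ by an element of $2\pi\mathbb Z^d$ are identified. For each $j$ let $\psi_j$ be the minimizer of $a(\psi,\psi)$ over all $\psi\in H^1_P(\Omega)$ with $(\psi,\phi_k)=\delta_{jk}$ for $k=1,\dots,N_H$, and let $\Psi_H=\operatorname{span}\{\psi_1,\dots,\psi_{N_H}\}$. Then there is a constant $C>0$, depending only on $d,\kappa_1,\kappa_2,c_0,V_{\min},V_{\max}$ (in particular not on $\varepsilon$, on $H$, on the mesh, or on $V$ otherwise), such that the following holds whenever $H\le c_0\varepsilon$. Let $f\in L^2(\Omega)$, let $u\in H^1_P(\Omega)$ solve $-\frac{\varepsilon^2}{2}\Delta u+Vu=f$ with periodic boundary conditions in the variational sense, that is, $a(u,v)=(f,v)$ for all $v\in H^1_P(\Omega)$, and let $u_H\in\Psi_H$ satisfy $a(u_H,v_H)=(f,v_H)$ for all $v_H\in\Psi_H$. Then $$\|u-u_H\|_e\le C\,\frac{H}{\varepsilon}\,\|f\|,\qquad \|u-u_H\|\le C\,\frac{H^2}{\varepsilon^2}\,\|f\|.$$ If moreover $f\in H^1_P(\Omega)$, then $$\|u-u_H\|_e\le C\,\frac{H^2}{\varepsilon}\,\|\nabla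 f\|,\qquad \|u-u_H\|\le C\,\frac{H^3}{\varepsilon^2}\,\|\nabla f\|.$$ -/

import Mathlib

open MeasureTheory
open scoped ContDiff ComplexConjugate

noncomputable section

namespace OCFEM

/-! ### The periodic cell and function spaces -/

/-- Euclidean space `ℝ^d`. -/
abbrev E (d : ℕ) : Type := EuclideanSpace ℝ (Fin d)

/-- The domain `Ω = [0, 2π]^d`. -/
def cell (d : ℕ) : Set (E d) := {x | ∀ i, x i ∈ Set.Icc (0 : ℝ) (2 * Real.pi)}

/-- Lebesgue measure on `Ω`. -/
abbrev cellMeasure (d : ℕ) : Measure (E d) := volume.restrict (cell d)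

/-- The `i`-th coordinate vector. -/
def unitVec {d : ℕ} (i : Fin d) : E d := EuclideanSpace.single i (1 : ℝ)

/-- The `i`-th period `2π eᵢ`. -/
def period {d : ℕ} (i : Fin d) : E d := EuclideanSpace.single i (2 * Real.pi)

/-- `x` and `y` are identified by the periodic boundary conditions: `x - y ∈ 2π ℤ^d`. -/
def PerEq {d : ℕ} (x y : E d) : Prop :=
  ∃ n : Fin d → ℤ, ∀ i, x i = y i + n i * (2 * Real.pi)

/-- The complex Hilbert space `L²(Ω)`. -/
abbrev L2 (d : ℕ) : Type := Lp ℂ 2 (cellMeasure d)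

/-- The `L²` inner product `(v, w) = ∫_Ω v w̄`. -/
def l2Inner {d : ℕ} (v w : L2 d) : ℂ := ∫ x, v x * conj (w x) ∂(cellMeasure d)

/-- Smooth functions on `ℝ^d` that are `2π`-periodic in each variable. -/
def IsPeriodicTest {d : ℕ} (φ : E d → ℂ) : Prop :=
  ContDiff ℝ ∞ φ ∧ ∀ x i, φ (x + period i) = φ x

/-- `g = ∇u` weakly on the periodic cell: `∫_Ω u ∂ᵢφ = -∫_Ω gᵢ φ` for all smooth periodic `φ`.
Test functions compactly supported in the interior of `Ω` say that `g` is the weak gradient of `u`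
in `Ω`; the remaining ones say that the boundary terms in Green's formula cancel, that is, that
the traces of `u` on opposite sides of `Ω` agree. -/
def HasPeriodicWeakGradient {d : ℕ} (u : L2 d) (g : Fin d → L2 d) : Prop :=
  ∀ φ : E d → ℂ, IsPeriodicTest φ → ∀ i,
    ∫ x, u x * fderiv ℝ φ x (unitVec i) ∂(cellMeasure d) = -∫ x, g i x * φ x ∂(cellMeasure d)

lemma isCompact_cell (d : ℕ) : IsCompact (cell d) := by
  have h : cell d = (EuclideanSpace.equiv (Fin d) ℝ).toHomeomorph ⁻¹'
      (Set.Icc (fun _ => (0 : ℝ)) (fun _ => 2 * Real.pi)) := by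
    ext x
    simp [cell, Pi.le_def, forall_and]
  rw [h, Homeomorph.isCompact_preimage]
  exact isCompact_Icc

lemma integrable_L2_mul {d : ℕ} (u : L2 d) {h : E d → ℂ} (hh : Continuous h) :
    Integrable (fun x => u x * h x) (cellMeasure d) := by
  have : IsFiniteMeasure (cellMeasure d) :=
    ⟨by simpa using (isCompact_cell d).measure_lt_top⟩
  have h1 : IntegrableOn (fun x => u x) (cell d) volume :=
    (Lp.memLp u).integrable (by norm_num)
  exact h1.mul_continuousOn hh.continuousOn (isCompact_cell d)

/-- The graph of the periodic weak gradient: all pairs `(u, ∇u)`. -/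
def gradGraph (d : ℕ) : Submodule ℂ (L2 d × (Fin d → L2 d)) where
  carrier := {p | HasPeriodicWeakGradient p.1 p.2}
  add_mem' := by
    rintro ⟨u, g⟩ ⟨v, k⟩ hu hv φ hφ i
    have hc : Continuous φ := hφ.1.continuous
    have hc' : Continuous fun x => fderiv ℝ φ x (unitVec i) :=
      (hφ.1.continuous_fderiv (by simp)).clm_apply continuous_const
    have e1 := hu φ hφ i
    have e2 := hv φ hφ i
    simp only at e1 e2
    have a1 : ∫ x, (u + v : L2 d) x * fderiv ℝ φ x (unitVec i) ∂(cellMeasure d)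
        = ∫ x, (u x * fderiv ℝ φ x (unitVec i) + v x * fderiv ℝ φ x (unitVec i))
          ∂(cellMeasure d) := by
      refine integral_congr_ae ?_
      filter_upwards [Lp.coeFn_add u v] with x hx
      rw [hx, Pi.add_apply, add_mul]
    have a2 : ∫ x, (g i + k i : L2 d) x * φ x ∂(cellMeasure d)
        = ∫ x, (g i x * φ x + k i x * φ x) ∂(cellMeasure d) := by
      refine integral_congr_ae ?_
      filter_upwards [Lp.coeFn_add (g i) (k i)] with x hx
      rw [hx, Pi.add_apply, add_mul]
    simp only [Prod.mk_add_mk, Pi.add_apply]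
    rw [a1, a2, integral_add (integrable_L2_mul u hc') (integrable_L2_mul v hc'),
      integral_add (integrable_L2_mul (g i) hc) (integrable_L2_mul (k i) hc), e1, e2, neg_add]
  zero_mem' := by
    intro φ _ i
    have a : ∀ h : E d → ℂ, ∫ x, (0 : L2 d) x * h x ∂(cellMeasure d) = 0 := by
      intro h
      refine integral_eq_zero_of_ae ?_
      filter_upwards [Lp.coeFn_zero ℂ 2 (cellMeasure d)] with x hx
      rw [hx]
      exact zero_mul _
    simp only [Prod.fst_zero, Prod.snd_zero, Pi.zero_apply]
    rw [a, a, neg_zero]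
  smul_mem' := by
    rintro c ⟨u, g⟩ hu φ hφ i
    have e := hu φ hφ i
    have a : ∀ (w : L2 d) (h : E d → ℂ), ∫ x, (c • w : L2 d) x * h x ∂(cellMeasure d)
        = c * ∫ x, w x * h x ∂(cellMeasure d) := by
      intro w h
      rw [← integral_const_mul]
      refine integral_congr_ae ?_
      filter_upwards [Lp.coeFn_smul c w] with x hx
      rw [hx, Pi.smul_apply, smul_eq_mul, mul_assoc]
    simp only [Prod.smul_mk, Pi.smul_apply] at e ⊢
    rw [a, a, e, mul_neg]

/-- The periodic Sobolev space `H¹_P(Ω)`. A member is a pair `(u, ∇u)` of an `L²` function and its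
periodic weak gradient (which is determined by `u`). -/
abbrev H1P (d : ℕ) : Type := gradGraph d

/-- The underlying `L²` function of a member of `H¹_P(Ω)`. -/
def H1P.fn {d : ℕ} (u : H1P d) : L2 d := u.1.1

/-- The weak gradient of a member of `H¹_P(Ω)`. -/
def H1P.grad {d : ℕ} (u : H1P d) : Fin d → L2 d := u.1.2

/-- `‖∇u‖`. -/
def H1P.gradNorm {d : ℕ} (u : H1P d) : ℝ := Real.sqrt (∑ i, ‖u.grad i‖ ^ 2)

/-! ### The Schrödinger form -/

/-- `a(v, w) = (ε²/2) (∇v, ∇w) + (V v, w)`. -/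
def form {d : ℕ} (ε : ℝ) (V : E d → ℝ) (v w : H1P d) : ℂ :=
  ((ε ^ 2 / 2 : ℝ) : ℂ) * ∑ i, l2Inner (v.grad i) (w.grad i)
    + ∫ x, (V x : ℂ) * v.fn x * conj (w.fn x) ∂(cellMeasure d)

/-- The energy norm `‖w‖_e = a(w, w)^{1/2}`. -/
def energyNorm {d : ℕ} (ε : ℝ) (V : E d → ℝ) (w : H1P d) : ℝ :=
  Real.sqrt (form ε V w w).re

/-- `u` solves `-(ε²/2) Δu + V u = f` with periodic boundary conditions (variational form). -/
def IsWeakSolution {d : ℕ} (ε : ℝ) (V : E d → ℝ) (f : L2 d) (u : H1P d) : Prop :=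
  ∀ v : H1P d, form ε V u v = l2Inner f v.fn

/-- `uH` is the Galerkin approximation, in the subspace `S` of `H¹_P(Ω)`, of the solution. -/
def IsGalerkinSolution {d : ℕ} (ε : ℝ) (V : E d → ℝ) (f : L2 d)
    (S : Submodule ℂ (H1P d)) (uH : H1P d) : Prop :=
  uH ∈ S ∧ ∀ v ∈ S, form ε V uH v = l2Inner f v.fn

/-! ### Simplicial meshes -/

/-- A conforming simplicial mesh of `Ω` which is compatible with the periodic boundary conditions:
the triangulations of opposite sides of `Ω` are translates of each other. -/
structure Mesh (d : ℕ) where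
  complex : Geometry.SimplicialComplex ℝ (E d)
  finite_faces : complex.faces.Finite
  space_eq : complex.space = cell d
  match_up : ∀ s ∈ complex.faces, ∀ i, (∀ x ∈ s, x i = 0) →
    s.map (addRightEmbedding (period i)) ∈ complex.faces
  match_down : ∀ s ∈ complex.faces, ∀ i, (∀ x ∈ s, x i = 2 * Real.pi) →
    s.map (addRightEmbedding (-period i)) ∈ complex.faces

namespace Mesh

variable {d : ℕ}

/-- The elements of the mesh, given by their vertex sets: the `d`-dimensional simplices. -/
def elements (M : Mesh d) : Set (Finset (E d)) := {s | s ∈ M.complex.faces ∧ s.card = d + 1}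

/-- The diameter of a simplex. -/
def simplexDiam (s : Finset (E d)) : ℝ := Metric.diam (convexHull ℝ (s : Set (E d)))

/-- The mesh size `H`: the largest diameter of an element. -/
def meshSize (M : Mesh d) : ℝ := sSup (simplexDiam '' M.elements)

/-- Shape regularity with constant `κ`: each element `T` contains a ball of some radius `ρ > 0`
with `diam T ≤ κ ρ`. -/
def IsShapeRegular (M : Mesh d) (κ : ℝ) : Prop :=
  ∀ s ∈ M.elements, ∃ c : E d, ∃ ρ : ℝ, 0 < ρ ∧
    Metric.closedBall c ρ ⊆ convexHull ℝ (s : Set (E d)) ∧ simplexDiam s ≤ κ * ρ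

/-- Quasi-uniformity with constant `κ`: `H ≤ κ diam T` for each element `T`. -/
def IsQuasiUniform (M : Mesh d) (κ : ℝ) : Prop :=
  ∀ s ∈ M.elements, M.meshSize ≤ κ * simplexDiam s

/-- The vertices of the mesh with repetitions due to the periodic boundary conditions removed:
from each class the unique vertex in `[0, 2π)^d` is kept. -/
def Node (M : Mesh d) : Type :=
  {p : E d // p ∈ M.complex.vertices ∧ ∀ i, p i < 2 * Real.pi}

/-- `w` are the barycentric coordinates of the point `x` in the simplex with vertex set `s`. -/
def IsBarycentric (s : Finset (E d)) (w : E d → ℝ) (x : E d) : Prop :=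
  (∀ q ∈ s, 0 ≤ w q) ∧ ∑ q ∈ s, w q = 1 ∧ ∑ q ∈ s, w q • q = x

open Classical in
/-- The possible values at `x` of the nodal basis function of the node `p`: write `x` in
barycentric coordinates in some simplex of the mesh and add up the coordinates belonging to the
vertices that are identified with `p`. For `x ∈ Ω` there is exactly one such value. -/
def hatValues (M : Mesh d) (p : M.Node) (x : E d) : Set ℝ :=
  {t | ∃ s ∈ M.complex.faces, ∃ w : E d → ℝ, IsBarycentric s w x ∧
    t = ∑ q ∈ s with PerEq q p.1, w q}

/-- The nodal basis function `φ_p` of the first-order periodic finite element space: on each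
element it is affine, it equals `1` at the vertices identified with `p` and `0` at the others. -/
def hat (M : Mesh d) (p : M.Node) (x : E d) : ℝ := sSup (M.hatValues p x)

lemma sum_eq_of_isBarycentric_subset (M : Mesh d) {s r : Finset (E d)}
    (hs : s ∈ M.complex.faces) (hr : r ⊆ s) {w v : E d → ℝ} {x : E d}
    (hw : IsBarycentric s w x) (hv : IsBarycentric r v x) (P : E d → Prop) [DecidablePred P] :
    ∑ q ∈ s with P q, w q = ∑ q ∈ r with P q, v q := by
  classical
  have hind := M.complex.indep hs
  rw [affineIndependent_iff] at hind
  have key : ∀ q ∈ s, w q = if q ∈ r then v q else 0 := by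
    intro q hq
    have h := hind Finset.univ (fun e => w e.1 - if e.1 ∈ r then v e.1 else 0) ?_ ?_ ⟨q, hq⟩
      (Finset.mem_univ _)
    · exact sub_eq_zero.mp h
    · rw [Finset.sum_coe_sort s (fun e => w e - if e ∈ r then v e else 0),
        Finset.sum_sub_distrib, hw.2.1, Finset.sum_ite_mem, Finset.inter_eq_right.mpr hr, hv.2.1,
        sub_self]
    · rw [Finset.sum_coe_sort s (fun e => (w e - if e ∈ r then v e else 0) • e)]
      simp only [sub_smul, ite_smul, zero_smul]
      rw [Finset.sum_sub_distrib, hw.2.2, Finset.sum_ite_mem, Finset.inter_eq_right.mpr hr, hv.2.2,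
        sub_self]
  rw [Finset.sum_congr rfl fun q hq => key q (Finset.mem_filter.mp hq).1]
  rw [Finset.sum_ite_mem]
  congr 1
  ext q
  simp only [Finset.mem_inter, Finset.mem_filter]
  constructor
  · rintro ⟨⟨_, h⟩, h'⟩
    exact ⟨h', h⟩
  · rintro ⟨h', h⟩
    exact ⟨⟨hr h', h⟩, h'⟩

open Classical in
/-- The value of a nodal basis function does not depend on the simplex used to compute it. -/
lemma hat_eq (M : Mesh d) (p : M.Node) {s : Finset (E d)} (hs : s ∈ M.complex.faces)
    {w : E d → ℝ} {x : E d} (hw : IsBarycentric s w x) :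
    M.hat p x = ∑ q ∈ s with PerEq q p.1, w q := by
  have hull : ∀ {t : Finset (E d)} {v : E d → ℝ}, IsBarycentric t v x →
      x ∈ convexHull ℝ (t : Set (E d)) := fun {t v} hv =>
    Finset.mem_convexHull'.mpr ⟨v, hv.1, hv.2.1, hv.2.2⟩
  have : M.hatValues p x = {∑ q ∈ s with PerEq q p.1, w q} := by
    ext t
    constructor
    · rintro ⟨s', hs', v, hv, rfl⟩
      have hx : x ∈ convexHull ℝ (((s ∩ s' : Finset (E d))) : Set (E d)) := by
        rw [Finset.coe_inter]
        exact M.complex.inter_subset_convexHull hs hs' ⟨hull hw, hull hv⟩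
      obtain ⟨z, hz0, hz1, hzx⟩ := Finset.mem_convexHull'.mp hx
      have hz : IsBarycentric (s ∩ s') z x := ⟨hz0, hz1, hzx⟩
      rw [Set.mem_singleton_iff,
        M.sum_eq_of_isBarycentric_subset hs' Finset.inter_subset_right hv hz,
        M.sum_eq_of_isBarycentric_subset hs Finset.inter_subset_left hw hz]
    · rintro rfl
      exact ⟨s, hs, w, hw, rfl⟩
  rw [hat, this, csSup_singleton]

end Mesh

/-! ### The operator-compressed multiscale space -/

/-- `(ψ, φ_k) = ∫_Ω ψ φ_k` (the nodal basis functions are real-valued). -/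
def moment {d : ℕ} (M : Mesh d) (ψ : H1P d) (k : M.Node) : ℂ :=
  ∫ x, ψ.fn x * (M.hat k x : ℂ) ∂(cellMeasure d)

open Classical in
/-- The constraints `(ψ, φ_k) = δ_{jk}` for all nodes `k`. -/
def Admissible {d : ℕ} (M : Mesh d) (j : M.Node) (ψ : H1P d) : Prop :=
  ∀ k : M.Node, moment M ψ k = if j = k then 1 else 0

/-- `ψ` is the operator-compressed basis function `ψ_j`: it minimizes the energy `a(ψ, ψ)` over
`H¹_P(Ω)` subject to the constraints. -/
def IsOCBasis {d : ℕ} (ε : ℝ) (V : E d → ℝ) (M : Mesh d) (j : M.Node) (ψ : H1P d) : Prop :=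
  Admissible M j ψ ∧
    ∀ χ : H1P d, Admissible M j χ → (form ε V ψ ψ).re ≤ (form ε V χ χ).re

/-- The global multiscale finite element space `Ψ_H = span {ψ_j}`. -/
def globalSpace {d : ℕ} (ε : ℝ) (V : E d → ℝ) (M : Mesh d) : Submodule ℂ (H1P d) :=
  Submodule.span ℂ {ψ | ∃ j : M.Node, IsOCBasis ε V M j ψ}

end OCFEM

end

/-!
Let `K` be the space of `w ∈ H¹_P(Ω)` whose moments `(w, φ_k)` against all nodal basis functions
vanish. Since `ψ_j` minimizes the energy under constraints on the moments, it is `a`-orthogonal to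
`K`, and the `ψ_j` span the `a`-orthogonal complement of `K`. The Galerkin error `e = u - u_H` is
`a`-orthogonal to `Ψ_H`, hence lies in `K`: it is `L²`-orthogonal to the finite element space
(`IsPotential.moment_error_eq_zero`). This uses that each `ψ_j` exists, which follows from the
completeness of `H¹_P(Ω)` in the energy norm and from the linear independence of the nodal basis
functions (`Mesh.surjective_momentCLM`).

Furthermore `‖e‖_e² = a(u, e) = (f, e)`, because `a(u_H, e) = 0`. If every `v ∈ H¹_P(Ω)` can be
approximated by a finite element function `g` with `‖v - g‖ ≤ C H ‖∇v‖`, then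
`‖e‖² = (e, e - g) ≤ C H ‖∇e‖ ‖e‖` and, for `f ∈ H¹_P(Ω)`, `|(f, e)| = |(f - g, e)| ≤
C H ‖∇f‖ ‖e‖`. All four estimates follow from these two and `(ε²/2) ‖∇e‖² ≤ ‖e‖_e²`.

The approximation property (`Mesh.exists_norm_sub_feFn_le`) holds with a constant depending on `d`
only. Extend `v` periodically and let the nodal value of `g` at `p` be the mean of `v` over the ball
of radius `H` about `p`. A point `x` of an element has distance at most `H` from its vertices, so
the balls about them lie in the ball of radius `2H` about `x`. Thus `|v(x) - g(x)|²` is at most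
`|B_H|⁻¹ ∫_{|z| ≤ 2H} |v(x) - v(x + z)|² dz`. Integration over `x` reduces the claim to the
translation estimate `‖v(· + z) - v‖ ≤ |z| ‖∇v‖` (`lintegral_perExt_translate_sub_le`), which is
Parseval's identity on the torus: the weak gradient tested with `exp(-i n·x)` gives the Fourier
coefficients of `∇v`, and `|exp(i n·z) - 1| ≤ |n·z|`.
-/

noncomputable section

namespace OCFEM

/-! ### Minimal-energy bases in a Hilbert space -/

/-- Let `m` be a surjective moment map onto `ℂ^ι`. A vector orthogonal to the minimal-norm
representative of each coordinate vector lies in `ker m`: these representatives form a basis of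
`(ker m)ᗮ`, on which `m` is injective. -/
theorem map_eq_zero_of_inner_minimizers_eq_zero {Y ι : Type*} [NormedAddCommGroup Y]
    [InnerProductSpace ℂ Y] [CompleteSpace Y] [Fintype ι] [DecidableEq ι]
    (m : Y →L[ℂ] (ι → ℂ)) (hm : Function.Surjective m) (e : Y)
    (he : ∀ j ψ, m ψ = Pi.single j 1 → (∀ χ, m χ = Pi.single j 1 → ‖ψ‖ ≤ ‖χ‖) →
      inner ℂ ψ e = 0) : m e = 0 := by
  let K : Submodule ℂ Y := LinearMap.ker (m : Y →ₗ[ℂ] (ι → ℂ))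
  have hK : IsClosed (K : Set Y) := m.isClosed_ker
  have : CompleteSpace K := hK.completeSpace_coe
  choose χ hχ using fun j => hm (Pi.single j (1 : ℂ))
  -- The minimizers are the preimages of the coordinate vectors orthogonal to the kernel.
  let ψ : ι → Y := fun j => χ j - K.starProjection (χ j)
  have hψK : ∀ j, ∀ k ∈ K, inner ℂ (ψ j) k = 0 := fun j k hk =>
    K.starProjection_inner_eq_zero (χ j) k hk
  have hmK : ∀ k ∈ K, m k = 0 := fun k hk => hk
  have hψm : ∀ j, m (ψ j) = Pi.single j 1 := fun j => by
    rw [map_sub, hχ, hmK _ (K.starProjection_apply_mem _), sub_zero]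
  have hmin : ∀ j φ, m φ = Pi.single j 1 → ‖ψ j‖ ≤ ‖φ‖ := by
    intro j φ hφ
    have hk : φ - ψ j ∈ K := by
      change m (φ - ψ j) = 0
      rw [map_sub, hφ, hψm, sub_self]
    have h := norm_add_sq_eq_norm_sq_add_norm_sq_of_inner_eq_zero (𝕜 := ℂ) (ψ j) (φ - ψ j)
      (hψK j _ hk)
    rw [add_sub_cancel] at h
    exact le_of_sq_le_sq (by nlinarith [norm_nonneg (φ - ψ j)]) (norm_nonneg _)
  have hψe : ∀ j, inner ℂ (ψ j) e = 0 := fun j => he j _ (hψm j) (hmin j)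
  -- `w` is the orthogonal projection of `e` to `(ker m)ᗮ`.
  set w : Y := ∑ j, m e j • ψ j with hw
  have hmw : m w = m e := by
    rw [hw, map_sum]
    ext i
    simp [hψm, Pi.single_apply]
  have hew : e - w ∈ K := by
    change m (e - w) = 0
    rw [map_sub, hmw, sub_self]
  have h1 : inner ℂ w e = 0 := by simp [hw, hψe]
  have h2 : inner ℂ w (e - w) = 0 := by
    rw [hw, sum_inner]
    refine Finset.sum_eq_zero fun j _ => ?_
    rw [inner_smul_left, hψK j _ hew, mul_zero]
  rw [inner_sub_right, h1, zero_sub, neg_eq_zero, inner_self_eq_zero] at h2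
  rw [← hmw, h2, map_zero]

/-- The same fact for an inner product `B` on a module that is carried by a linear equivalence to a
complete normed space whose norm is equivalent to the one induced by `B`. The two modules are kept
apart because `H¹_P(Ω)` already carries a norm, which does not come from an inner product. -/
theorem map_eq_zero_of_core_minimizers_eq_zero {X Y ι : Type*} [NormedAddCommGroup X]
    [NormedSpace ℂ X] [CompleteSpace X] [AddCommGroup Y] [Module ℂ Y] [Fintype ι] [DecidableEq ι]
    (T : X ≃ₗ[ℂ] Y) (B : InnerProductSpace.Core ℂ Y) {α β : ℝ} (hα : 0 < α)
    (hlow : ∀ x, α * ‖x‖ ^ 2 ≤ (B.inner (T x) (T x)).re)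
    (hupp : ∀ x, (B.inner (T x) (T x)).re ≤ β * ‖x‖ ^ 2)
    (m : X →L[ℂ] (ι → ℂ)) (hm : Function.Surjective m) (e : X)
    (he : ∀ j ψ, m ψ = Pi.single j 1 →
      (∀ χ, m χ = Pi.single j 1 → (B.inner (T ψ) (T ψ)).re ≤ (B.inner (T χ) (T χ)).re) →
      B.inner (T ψ) (T e) = 0) :
    m e = 0 := by
  let N : NormedAddCommGroup Y := B.toNormedAddCommGroup
  let I : InnerProductSpace ℂ Y := InnerProductSpace.ofCore B.toCore
  have hN : ∀ y : Y, ‖y‖ ^ 2 = (B.inner y y).re := fun y =>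
    InnerProductSpace.norm_sq_eq_re_inner (𝕜 := ℂ) y
  have hβ : ∀ x, ‖T x‖ ≤ Real.sqrt β * ‖x‖ := fun x => by
    rw [← Real.sqrt_sq (norm_nonneg (T x)), hN]
    refine (Real.sqrt_le_sqrt (hupp x)).trans ?_
    rw [Real.sqrt_mul' _ (sq_nonneg _), Real.sqrt_sq (norm_nonneg _)]
  have hα' : ∀ y, ‖T.symm y‖ ≤ (Real.sqrt α)⁻¹ * ‖y‖ := fun y => by
    have h := hlow (T.symm y)
    rw [T.apply_symm_apply, ← hN] at h
    have h' := Real.sqrt_le_sqrt h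
    rw [Real.sqrt_mul' _ (sq_nonneg _), Real.sqrt_sq (norm_nonneg _),
      Real.sqrt_sq (norm_nonneg _)] at h'
    rw [inv_mul_eq_div, le_div_iff₀ (Real.sqrt_pos.mpr hα), mul_comm]
    exact h'
  let S : X ≃L[ℂ] Y := T.toContinuousLinearEquivOfBounds _ _ hβ hα'
  have hS : ∀ x, S x = T x := fun _ => rfl
  have : CompleteSpace Y := (completeSpace_congr (e := S.toEquiv) S.isUniformEmbedding).mp
    inferInstance
  have key := map_eq_zero_of_inner_minimizers_eq_zero (m.comp (S.symm : Y →L[ℂ] X))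
    (hm.comp S.symm.surjective) (S e) ?_
  · simpa using key
  · intro j ψ hψ hmin
    have h := he j (S.symm ψ) hψ fun χ hχ => ?_
    · rw [← hS, ← hS, S.apply_symm_apply] at h
      exact h
    · have h1 := hmin (S χ) (by simpa using hχ)
      rw [← hS, ← hS, S.apply_symm_apply, ← hN, ← hN]
      gcongr

/-! ### The Schrödinger form -/

variable {d : ℕ}

instance : IsFiniteMeasure (cellMeasure d) :=
  ⟨by simpa using (isCompact_cell d).measure_lt_top⟩

lemma l2Inner_eq_inner (v w : L2 d) : l2Inner v w = inner ℂ w v := by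
  rw [l2Inner, L2.inner_def]
  simp only [RCLike.inner_apply]

lemma measurableSet_cell (d : ℕ) : MeasurableSet (cell d) := (isCompact_cell d).measurableSet

lemma form_smul_left (c : ℂ) (ε : ℝ) (V : E d → ℝ) (v w : H1P d) :
    form ε V (c • v) w = c * form ε V v w := by
  have h : ∫ x, (V x : ℂ) * (c • v).fn x * conj (w.fn x) ∂(cellMeasure d)
      = c * ∫ x, (V x : ℂ) * v.fn x * conj (w.fn x) ∂(cellMeasure d) := by
    rw [← integral_const_mul]
    refine integral_congr_ae ?_
    filter_upwards [Lp.coeFn_smul c v.fn] with x hx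
    change _ * (c • v.fn : L2 d) x * _ = _
    rw [hx, Pi.smul_apply, smul_eq_mul]
    ring
  have hg : ∀ i, (c • v).grad i = c • v.grad i := fun _ => rfl
  simp only [form, h, hg, l2Inner_eq_inner, inner_smul_right, ← Finset.mul_sum]
  ring

lemma form_conj_symm (ε : ℝ) (V : E d → ℝ) (v w : H1P d) :
    conj (form ε V v w) = form ε V w v := by
  simp only [form, map_add, map_mul, map_sum, Complex.conj_ofReal, l2Inner_eq_inner,
    inner_conj_symm, ← integral_conj, Complex.conj_conj]
  congr 1
  refine integral_congr_ae (ae_of_all _ fun x => ?_)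
  ring

lemma norm_sq_eq_integral (v : L2 d) : ‖v‖ ^ 2 = ∫ x, ‖v x‖ ^ 2 ∂(cellMeasure d) := by
  have h := inner_self_eq_norm_sq_to_K (𝕜 := ℂ) v
  rw [L2.inner_def] at h
  have h2 : ∫ x, inner ℂ (v x) (v x) ∂(cellMeasure d)
      = ((∫ x, ‖v x‖ ^ 2 ∂(cellMeasure d) : ℝ) : ℂ) := by
    rw [← integral_complex_ofReal]
    refine integral_congr_ae (ae_of_all _ fun x => ?_)
    simp only [inner_self_eq_norm_sq_to_K, Complex.coe_algebraMap, Complex.ofReal_pow]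
  rw [h2, ← RCLike.ofReal_pow] at h
  exact (Complex.ofReal_injective h).symm

lemma integrable_norm_sq (v : L2 d) : Integrable (fun x => ‖v x‖ ^ 2) (cellMeasure d) :=
  (Lp.memLp v).integrable_norm_pow (by norm_num)

lemma gradNorm_sq (w : H1P d) : w.gradNorm ^ 2 = ∑ i, ‖w.grad i‖ ^ 2 :=
  Real.sq_sqrt (Finset.sum_nonneg fun _ _ => sq_nonneg _)

lemma gradNorm_nonneg (w : H1P d) : 0 ≤ w.gradNorm := Real.sqrt_nonneg _

lemma form_self_re (ε : ℝ) (V : E d → ℝ) (w : H1P d) :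
    (form ε V w w).re
      = ε ^ 2 / 2 * w.gradNorm ^ 2 + ∫ x, V x * ‖w.fn x‖ ^ 2 ∂(cellMeasure d) := by
  have h : ∫ x, (V x : ℂ) * w.fn x * conj (w.fn x) ∂(cellMeasure d)
      = ((∫ x, V x * ‖w.fn x‖ ^ 2 ∂(cellMeasure d) : ℝ) : ℂ) := by
    rw [← integral_complex_ofReal]
    refine integral_congr_ae (ae_of_all _ fun x => ?_)
    simp only [mul_assoc, Complex.mul_conj, Complex.normSq_eq_norm_sq]
    push_cast
    rfl
  simp only [form, h, l2Inner_eq_inner, gradNorm_sq, inner_self_eq_norm_sq_to_K,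
    Complex.coe_algebraMap]
  norm_cast

lemma norm_fn_le (w : H1P d) : ‖w.fn‖ ≤ ‖w‖ := norm_fst_le (w : L2 d × (Fin d → L2 d))

lemma norm_grad_le (w : H1P d) (i : Fin d) : ‖w.grad i‖ ≤ ‖w‖ :=
  (norm_le_pi_norm (w : L2 d × (Fin d → L2 d)).2 i).trans
    (norm_snd_le (w : L2 d × (Fin d → L2 d)))

lemma norm_grad_le_gradNorm (w : H1P d) (i : Fin d) : ‖w.grad i‖ ≤ w.gradNorm :=
  Real.le_sqrt_of_sq_le
    (Finset.single_le_sum (f := fun i => ‖w.grad i‖ ^ 2) (fun _ _ => sq_nonneg _)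
      (Finset.mem_univ i))

lemma norm_le_max (w : H1P d) : ‖w‖ ≤ max ‖w.fn‖ w.gradNorm :=
  max_le_max le_rfl ((pi_norm_le_iff_of_nonneg (gradNorm_nonneg w)).mpr (norm_grad_le_gradNorm w))

/-- A potential on the cell which is measurable and bounded between two positive constants. -/
structure IsPotential (V : E d → ℝ) (a b : ℝ) : Prop where
  aemeasurable : AEMeasurable V (cellMeasure d)
  pos : 0 < a
  bounds : ∀ x ∈ cell d, a ≤ V x ∧ V x ≤ b

namespace IsPotential

variable {V : E d → ℝ} {a b : ℝ}

lemma ae_bounds (hV : IsPotential V a b) : ∀ᵐ x ∂(cellMeasure d), a ≤ V x ∧ V x ≤ b :=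
  (ae_restrict_mem (measurableSet_cell d)).mono hV.bounds

lemma integrable_mul (hV : IsPotential V a b) (v w : L2 d) :
    Integrable (fun x => (V x : ℂ) * v x * conj (w x)) (cellMeasure d) := by
  have h : Integrable (fun x => (V x : ℂ) * (v x * conj (w x))) (cellMeasure d) := by
    refine Integrable.bdd_mul (c := b) ?_ ?_ ?_
    · simpa [RCLike.inner_apply] using L2.integrable_inner (𝕜 := ℂ) w v
    · exact (Complex.measurable_ofReal.comp_aemeasurable hV.aemeasurable).aestronglyMeasurable
    · filter_upwards [hV.ae_bounds] with x hx
      rw [Complex.norm_real, Real.norm_of_nonneg (hV.pos.le.trans hx.1)]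
      exact hx.2
  simpa only [mul_assoc] using h

lemma form_add_left (hV : IsPotential V a b) (ε : ℝ) (u v w : H1P d) :
    form ε V (u + v) w = form ε V u w + form ε V v w := by
  have h : ∫ x, (V x : ℂ) * (u + v).fn x * conj (w.fn x) ∂(cellMeasure d)
      = ∫ x, (V x : ℂ) * u.fn x * conj (w.fn x) ∂(cellMeasure d)
        + ∫ x, (V x : ℂ) * v.fn x * conj (w.fn x) ∂(cellMeasure d) := by
    rw [← integral_add (hV.integrable_mul _ _) (hV.integrable_mul _ _)]
    refine integral_congr_ae ?_
    filter_upwards [Lp.coeFn_add u.fn v.fn] with x hx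
    change _ * (u.fn + v.fn : L2 d) x * _ = _
    rw [hx, Pi.add_apply]
    ring
  have hg : ∀ i, (u + v).grad i = u.grad i + v.grad i := fun _ => rfl
  simp only [form, h, hg, l2Inner_eq_inner, inner_add_right, Finset.sum_add_distrib]
  ring

lemma integrable_mul_norm_sq (hV : IsPotential V a b) (v : L2 d) :
    Integrable (fun x => V x * ‖v x‖ ^ 2) (cellMeasure d) := by
  refine Integrable.bdd_mul (c := b) (integrable_norm_sq v)
    hV.aemeasurable.aestronglyMeasurable ?_
  filter_upwards [hV.ae_bounds] with x hx
  rw [Real.norm_of_nonneg (hV.pos.le.trans hx.1)]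
  exact hx.2

lemma le_form_self_re (hV : IsPotential V a b) (ε : ℝ) (w : H1P d) :
    ε ^ 2 / 2 * w.gradNorm ^ 2 + a * ‖w.fn‖ ^ 2 ≤ (form ε V w w).re := by
  rw [form_self_re, norm_sq_eq_integral w.fn, ← integral_const_mul]
  gcongr 1
  refine integral_mono_ae ((integrable_norm_sq _).const_mul a) (hV.integrable_mul_norm_sq _) ?_
  filter_upwards [hV.ae_bounds] with x hx
  exact mul_le_mul_of_nonneg_right hx.1 (sq_nonneg _)

lemma form_self_re_le (hV : IsPotential V a b) (ε : ℝ) (w : H1P d) :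
    (form ε V w w).re ≤ ε ^ 2 / 2 * w.gradNorm ^ 2 + b * ‖w.fn‖ ^ 2 := by
  rw [form_self_re, norm_sq_eq_integral w.fn, ← integral_const_mul]
  gcongr 1
  refine integral_mono_ae (hV.integrable_mul_norm_sq _) ((integrable_norm_sq _).const_mul b) ?_
  filter_upwards [hV.ae_bounds] with x hx
  exact mul_le_mul_of_nonneg_right hx.2 (sq_nonneg _)

lemma form_self_re_nonneg (hV : IsPotential V a b) (ε : ℝ) (w : H1P d) :
    0 ≤ (form ε V w w).re :=
  le_trans (by have := hV.pos; positivity) (hV.le_form_self_re ε w)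

lemma energyNorm_sq (hV : IsPotential V a b) (ε : ℝ) (w : H1P d) :
    energyNorm ε V w ^ 2 = (form ε V w w).re :=
  Real.sq_sqrt (hV.form_self_re_nonneg ε w)

lemma min_mul_norm_sq_le_form (hV : IsPotential V a b) (ε : ℝ) (w : H1P d) :
    min a (ε ^ 2 / 2) * ‖w‖ ^ 2 ≤ (form ε V w w).re := by
  refine le_trans ?_ (hV.le_form_self_re ε w)
  have ha := hV.pos
  have hμ : 0 ≤ min a (ε ^ 2 / 2) := le_min ha.le (by positivity)
  have h1 : ‖w‖ ^ 2 ≤ ‖w.fn‖ ^ 2 + w.gradNorm ^ 2 := by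
    rcases le_max_iff.mp (norm_le_max w) with h | h
    · nlinarith [norm_nonneg w, sq_nonneg w.gradNorm]
    · nlinarith [norm_nonneg w, sq_nonneg ‖w.fn‖]
  calc min a (ε ^ 2 / 2) * ‖w‖ ^ 2 ≤ min a (ε ^ 2 / 2) * (‖w.fn‖ ^ 2 + w.gradNorm ^ 2) := by gcongr
    _ = min a (ε ^ 2 / 2) * w.gradNorm ^ 2 + min a (ε ^ 2 / 2) * ‖w.fn‖ ^ 2 := by ring
    _ ≤ _ := by gcongr <;> simp

lemma form_le_mul_norm_sq (hV : IsPotential V a b) (ε : ℝ) (w : H1P d) :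
    (form ε V w w).re ≤ (ε ^ 2 / 2 * d + |b|) * ‖w‖ ^ 2 := by
  refine (hV.form_self_re_le ε w).trans ?_
  rw [add_mul, mul_assoc, gradNorm_sq]
  gcongr
  · calc ∑ i, ‖w.grad i‖ ^ 2 ≤ ∑ _i : Fin d, ‖w‖ ^ 2 := by
          gcongr with i; exact norm_grad_le w i
      _ = d * ‖w‖ ^ 2 := by simp
  · exact le_abs_self b
  · exact norm_fn_le w

/-- The Schrödinger form as an inner product on `H¹_P(Ω)`; Mathlib's inner products are linear in
the second argument, hence the swap. -/
abbrev core (hV : IsPotential V a b) {ε : ℝ} (hε : 0 < ε) : InnerProductSpace.Core ℂ (H1P d) where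
  inner v w := form ε V w v
  conj_inner_symm v w := form_conj_symm ε V v w
  re_inner_nonneg w := hV.form_self_re_nonneg ε w
  add_left u v w := by
    rw [← form_conj_symm, hV.form_add_left, map_add, form_conj_symm, form_conj_symm]
  smul_left v w c := by
    rw [← form_conj_symm, form_smul_left, map_mul, form_conj_symm]
  definite w hw := by
    have h := hV.min_mul_norm_sq_le_form ε w
    rw [hw, Complex.zero_re] at h
    have hμ : 0 < min a (ε ^ 2 / 2) := lt_min hV.pos (by positivity)
    have : ‖w‖ ^ 2 = 0 := le_antisymm (nonpos_of_mul_nonpos_right h hμ) (sq_nonneg _)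
    simpa using this

end IsPotential

/-! ### Periodic functions and the torus -/

/-- The torus `(ℝ/ℤ)^d`. -/
abbrev Torus (d : ℕ) : Type := UnitAddTorus (Fin d)

/-- The Haar probability measure on the torus. -/
abbrev torusMeasure (d : ℕ) : Measure (Torus d) :=
  Measure.pi fun _ => (AddCircle.haarAddCircle : Measure UnitAddCircle)

/-- The covering map `ℝ^d → (ℝ/ℤ)^d` that divides out the periods `2π eᵢ`. -/
def toTorus (x : E d) : Torus d := fun i => ((x i / (2 * Real.pi) : ℝ) : UnitAddCircle)

/-- The section of `toTorus` with values in `[0, 2π)^d`. -/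
def torusSection (t : Torus d) : E d :=
  WithLp.toLp 2 fun i => 2 * Real.pi * (AddCircle.equivIco 1 0 (t i) : ℝ)

lemma toTorus_add (x y : E d) : toTorus (x + y) = toTorus x + toTorus y := by
  ext i
  simp only [toTorus, PiLp.add_apply, Pi.add_apply, add_div]
  exact AddCircle.coe_add 1 _ _

lemma toTorus_eq_of_perEq {x y : E d} (h : PerEq x y) : toTorus x = toTorus y := by
  obtain ⟨n, hn⟩ := h
  ext i
  simp only [toTorus, hn i, add_div, mul_div_assoc, div_self Real.two_pi_pos.ne', mul_one]
  rw [AddCircle.coe_add, add_eq_left]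
  exact (AddCircle.coe_eq_zero_iff 1).mpr ⟨n i, by simp⟩

lemma measurable_toTorus : Measurable (toTorus : E d → Torus d) :=
  measurable_pi_lambda _ fun i => AddCircle.measurable_mk'.comp (by fun_prop)

lemma measurable_torusSection : Measurable (torusSection : Torus d → E d) := by
  refine (WithLp.measurable_toLp 2 _).comp (measurable_pi_lambda _ fun i => ?_)
  exact (measurable_subtype_coe.comp
    ((AddCircle.measurableEquivIco 1 0).measurable.comp (measurable_pi_apply i))).const_mul _

lemma torusSection_toTorus {x : E d} (hx : ∀ i, x i ∈ Set.Ico (0 : ℝ) (2 * Real.pi)) :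
    torusSection (toTorus x) = x := by
  ext i
  have h2 := Real.two_pi_pos
  have h : x i / (2 * Real.pi) ∈ Set.Ico (0 : ℝ) (0 + 1) :=
    ⟨div_nonneg (hx i).1 h2.le, by rw [zero_add, div_lt_one h2]; exact (hx i).2⟩
  simp only [torusSection, toTorus]
  rw [AddCircle.equivIco_coe_eq h]
  field_simp

lemma map_div_restrict_Icc :
    Measure.map (fun x : ℝ => ((x / (2 * Real.pi) : ℝ) : UnitAddCircle))
      (volume.restrict (Set.Icc 0 (2 * Real.pi)))
      = ENNReal.ofReal (2 * Real.pi) • AddCircle.haarAddCircle := by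
  have h2 := Real.two_pi_pos
  have h1 : Measure.map (fun x : ℝ => x / (2 * Real.pi)) (volume.restrict (Set.Icc 0 (2 * Real.pi)))
      = ENNReal.ofReal (2 * Real.pi) • volume.restrict (Set.Ioc (0 : ℝ) (0 + 1)) := by
    have hpre : Set.Icc 0 (2 * Real.pi) = (fun x : ℝ => x / (2 * Real.pi)) ⁻¹' Set.Icc 0 1 := by
      ext x
      simp [div_le_one h2, le_div_iff₀ h2]
    rw [hpre, ← Measure.restrict_map (by fun_prop) measurableSet_Icc]
    simp only [div_eq_mul_inv]
    rw [Real.map_volume_mul_right (inv_ne_zero h2.ne'), inv_inv, abs_of_pos h2,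
      Measure.restrict_smul, zero_add, restrict_Ioc_eq_restrict_Icc]
  have h3 := (AddCircle.measurePreserving_mk 1 0).map_eq
  rw [AddCircle.volume_eq_smul_haarAddCircle, ENNReal.ofReal_one, one_smul] at h3
  rw [← h3, ← Measure.map_smul, ← h1, Measure.map_map AddCircle.measurable_mk' (by fun_prop)]
  rfl

/-- Lebesgue measure on the cell is mapped to `(2π)^d` times the Haar probability measure. -/
lemma map_toTorus (d : ℕ) : Measure.map toTorus (cellMeasure d)
    = ENNReal.ofReal (2 * Real.pi) ^ d • torusMeasure d := by
  have hcell : cell d = (WithLp.ofLp : E d → Fin d → ℝ) ⁻¹'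
      Set.univ.pi fun _ => Set.Icc 0 (2 * Real.pi) := by
    ext x
    simp only [cell, Set.mem_ofPred_eq, Set.mem_preimage, Set.mem_univ_pi]
  have h1 : Measure.map (WithLp.ofLp : E d → Fin d → ℝ) (cellMeasure d)
      = Measure.pi fun _ => volume.restrict (Set.Icc 0 (2 * Real.pi)) := by
    rw [cellMeasure, hcell, ← Measure.restrict_map (WithLp.measurable_ofLp 2 _)
      (MeasurableSet.univ_pi fun _ => measurableSet_Icc),
      (PiLp.volume_preserving_ofLp (Fin d)).map_eq, volume_pi,
      Measure.restrict_pi_pi]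
  have h2 : (toTorus : E d → Torus d)
      = (fun x : Fin d → ℝ => fun i => ((x i / (2 * Real.pi) : ℝ) : UnitAddCircle)) ∘
        WithLp.ofLp := rfl
  have hm : Measurable fun x : ℝ => ((x / (2 * Real.pi) : ℝ) : UnitAddCircle) :=
    AddCircle.measurable_mk'.comp (by fun_prop)
  rw [h2, ← Measure.map_map (by
      exact measurable_pi_lambda _ fun i => hm.comp (measurable_pi_apply i))
    (WithLp.measurable_ofLp 2 _), h1]
  have hfin : IsFiniteMeasure
      (ENNReal.ofReal (2 * Real.pi) • (AddCircle.haarAddCircle : Measure UnitAddCircle)) :=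
    Measure.smul_finite _ ENNReal.ofReal_ne_top
  have : ∀ i : Fin d, SigmaFinite (Measure.map
      (fun x : ℝ => ((x / (2 * Real.pi) : ℝ) : UnitAddCircle))
      (volume.restrict (Set.Icc 0 (2 * Real.pi)))) := fun i => by
    rw [map_div_restrict_Icc]; infer_instance
  rw [Measure.pi_map_pi fun _ => hm.aemeasurable]
  simp only [map_div_restrict_Icc]
  refine (Measure.pi_eq fun s hs => ?_)
  simp [Measure.smul_apply, Measure.pi_pi, Finset.prod_mul_distrib]

lemma lintegral_toTorus {F : Torus d → ENNReal} (hF : Measurable F) :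
    ∫⁻ x, F (toTorus x) ∂(cellMeasure d)
      = ENNReal.ofReal (2 * Real.pi) ^ d * ∫⁻ t, F t ∂(torusMeasure d) := by
  rw [← lintegral_map hF measurable_toTorus, map_toTorus, lintegral_smul_measure, smul_eq_mul]

lemma integral_toTorus {F : Torus d → ℂ} (hF : StronglyMeasurable F) :
    ∫ x, F (toTorus x) ∂(cellMeasure d)
      = ((2 * Real.pi) ^ d : ℝ) • ∫ t, F t ∂(torusMeasure d) := by
  rw [← integral_map measurable_toTorus.aemeasurable hF.aestronglyMeasurable, map_toTorus,
    integral_smul_measure, ENNReal.toReal_pow, ENNReal.toReal_ofReal Real.two_pi_pos.le]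

lemma ae_mem_Ico (d : ℕ) :
    ∀ᵐ x ∂(cellMeasure d), ∀ i, x i ∈ Set.Ico (0 : ℝ) (2 * Real.pi) := by
  rw [ae_all_iff]
  intro i
  have h : ∀ᵐ x : E d, x i ≠ 2 * Real.pi := by
    have hp := (PiLp.volume_preserving_ofLp (Fin d)).quasiMeasurePreserving
    have hq : ∀ᵐ x : Fin d → ℝ, x i ≠ 2 * Real.pi :=
      (Measure.quasiMeasurePreserving_eval (μ := fun _ : Fin d => (volume : Measure ℝ)) i).ae
        (Measure.ae_ne volume _)
    exact hp.ae hq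
  filter_upwards [ae_restrict_of_ae h, ae_restrict_mem (measurableSet_cell d)] with x h1 h2
  exact ⟨(h2 i).1, lt_of_le_of_ne (h2 i).2 h1⟩

/-- An `L²` function on the cell, as a function on the torus. -/
def torusFn (v : L2 d) (t : Torus d) : ℂ := v (torusSection t)

/-- The periodic extension of an `L²` function on the cell. -/
def perExt (v : L2 d) (x : E d) : ℂ := torusFn v (toTorus x)

lemma stronglyMeasurable_torusFn (v : L2 d) : StronglyMeasurable (torusFn v) :=
  (Lp.stronglyMeasurable v).comp_measurable measurable_torusSection

lemma stronglyMeasurable_perExt (v : L2 d) : StronglyMeasurable (perExt v) :=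
  (stronglyMeasurable_torusFn v).comp_measurable measurable_toTorus

lemma perExt_ae_eq (v : L2 d) : perExt v =ᵐ[cellMeasure d] v := by
  filter_upwards [ae_mem_Ico d] with x hx
  rw [perExt, torusFn, torusSection_toTorus hx]

lemma perExt_add_eq_of_perEq (v : L2 d) {x y : E d} (h : PerEq x y) (z : E d) :
    perExt v (x + z) = perExt v (y + z) := by
  rw [perExt, perExt, toTorus_add, toTorus_add, toTorus_eq_of_perEq h]

lemma lintegral_enorm_sq (v : L2 d) :
    ∫⁻ x, ‖v x‖ₑ ^ 2 ∂(cellMeasure d) = ENNReal.ofReal (‖v‖ ^ 2) := by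
  rw [norm_sq_eq_integral, ofReal_integral_eq_lintegral_ofReal
    (integrable_norm_sq v) (ae_of_all _ fun _ => sq_nonneg _)]
  refine lintegral_congr fun x => ?_
  rw [ENNReal.ofReal_pow (norm_nonneg _), ofReal_norm]

lemma lintegral_torusFn (v : L2 d) :
    ENNReal.ofReal (2 * Real.pi) ^ d * ∫⁻ t, ‖torusFn v t‖ₑ ^ 2 ∂(torusMeasure d)
      = ENNReal.ofReal (‖v‖ ^ 2) := by
  rw [← lintegral_toTorus ((stronglyMeasurable_torusFn v).measurable.enorm.pow_const 2),
    ← lintegral_enorm_sq]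
  refine lintegral_congr_ae ?_
  filter_upwards [perExt_ae_eq v] with x hx
  rw [← hx, perExt]

lemma memLp_torusFn (v : L2 d) : MemLp (torusFn v) 2 (torusMeasure d) := by
  refine ⟨(stronglyMeasurable_torusFn v).aestronglyMeasurable, ?_⟩
  rw [eLpNorm_lt_top_iff_lintegral_rpow_enorm_lt_top (by norm_num) (by norm_num)]
  have h : ∫⁻ t, ‖torusFn v t‖ₑ ^ 2 ∂(torusMeasure d) ≠ ⊤ := by
    intro h
    have := lintegral_torusFn v
    rw [h, ENNReal.mul_top] at this
    · exact ENNReal.ofReal_ne_top this.symm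
    · simpa using fun h => absurd h Real.pi_pos.not_ge
  simpa using h.lt_top

/-! ### Fourier coefficients and translation -/

/-- The Fourier coefficients of a function on the torus. -/
def torusCoeff (F : Torus d → ℂ) (n : Fin d → ℤ) : ℂ :=
  ∫ t, UnitAddTorus.mFourier (-n) t * F t ∂(torusMeasure d)

/-- Parseval's identity. -/
lemma hasSum_torusCoeff_sq {F : Torus d → ℂ} (hF : MemLp F 2 (torusMeasure d)) :
    HasSum (fun n => ‖torusCoeff F n‖ ^ 2) (∫ t, ‖F t‖ ^ 2 ∂(torusMeasure d)) := by
  have h := UnitAddTorus.hasSum_sq_mFourierCoeff hF.toLp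
  have e1 : ∀ n, UnitAddTorus.mFourierCoeff hF.toLp n = torusCoeff F n := fun n => by
    refine integral_congr_ae ?_
    filter_upwards [hF.coeFn_toLp] with t ht
    rw [ht, smul_eq_mul]
  have e2 : ∫ t, ‖hF.toLp F t‖ ^ 2 ∂(torusMeasure d) = ∫ t, ‖F t‖ ^ 2 ∂(torusMeasure d) := by
    refine integral_congr_ae ?_
    filter_upwards [hF.coeFn_toLp] with t ht
    rw [ht]
  simp only [e1] at h
  rw [← e2]
  exact h

lemma mFourier_add_apply (n : Fin d → ℤ) (s t : Torus d) :
    UnitAddTorus.mFourier n (s + t) = UnitAddTorus.mFourier n s * UnitAddTorus.mFourier n t := by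
  simp only [UnitAddTorus.mFourier, ContinuousMap.coe_mk, Pi.add_apply,
    ← Finset.prod_mul_distrib]
  refine Finset.prod_congr rfl fun i _ => ?_
  simp [fourier_apply, smul_add, AddCircle.toCircle_add]

lemma mFourier_toTorus (n : Fin d → ℤ) (x : E d) :
    UnitAddTorus.mFourier n (toTorus x) = Complex.exp (Complex.I * (∑ i, n i * x i : ℝ)) := by
  simp only [UnitAddTorus.mFourier, ContinuousMap.coe_mk, toTorus, fourier_coe_apply,
    ← Complex.exp_sum]
  congr 1
  push_cast
  rw [Finset.mul_sum]
  refine Finset.sum_congr rfl fun i _ => ?_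
  have : (Real.pi : ℂ) ≠ 0 := by exact_mod_cast Real.pi_ne_zero
  field_simp

lemma integrable_mFourier_mul {F : Torus d → ℂ} (hF : MemLp F 2 (torusMeasure d))
    (n : Fin d → ℤ) : Integrable (fun t => UnitAddTorus.mFourier n t * F t) (torusMeasure d) := by
  refine Integrable.bdd_mul (c := 1) (hF.integrable (by norm_num))
    (UnitAddTorus.mFourier n).continuous.aestronglyMeasurable (ae_of_all _ fun t => ?_)
  exact ((UnitAddTorus.mFourier n).norm_coe_le_norm t).trans UnitAddTorus.mFourier_norm.le

lemma memLp_translate {F : Torus d → ℂ} (hF : MemLp F 2 (torusMeasure d)) (a : Torus d) :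
    MemLp (fun t => F (t + a)) 2 (torusMeasure d) :=
  hF.comp_measurePreserving (measurePreserving_add_right (torusMeasure d) a)

lemma torusCoeff_translate_sub {F : Torus d → ℂ} (hF : MemLp F 2 (torusMeasure d)) (a : Torus d)
    (n : Fin d → ℤ) : torusCoeff (fun t => F (t + a) - F t) n
      = (UnitAddTorus.mFourier n a - 1) * torusCoeff F n := by
  have h1 : ∫ t, UnitAddTorus.mFourier (-n) t * F (t + a) ∂(torusMeasure d)
      = UnitAddTorus.mFourier n a * torusCoeff F n := by
    rw [torusCoeff, ← integral_add_right_eq_self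
      (fun t => UnitAddTorus.mFourier (-n) t * F t) a, ← integral_const_mul]
    refine integral_congr_ae (ae_of_all _ fun t => ?_)
    have h : UnitAddTorus.mFourier n a * UnitAddTorus.mFourier (-n) a = 1 := by
      rw [← UnitAddTorus.mFourier_add, add_neg_cancel, UnitAddTorus.mFourier_zero]
      rfl
    simp only [mFourier_add_apply]
    linear_combination (- UnitAddTorus.mFourier (-n) t * F (t + a)) * h
  simp only [torusCoeff, mul_sub]
  rw [integral_sub (integrable_mFourier_mul (memLp_translate hF a) _)
    (integrable_mFourier_mul hF _), h1, torusCoeff]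
  ring

/-- The test function `exp(-i n·x)`. -/
def expTest (n : Fin d → ℤ) (x : E d) : ℂ :=
  Complex.exp (Complex.I * (∑ i, ((-n) i : ℤ) * x i : ℝ))

lemma expTest_eq (n : Fin d → ℤ) (x : E d) :
    expTest n x = UnitAddTorus.mFourier (-n) (toTorus x) := (mFourier_toTorus _ _).symm

lemma perEq_add_period (x : E d) (i : Fin d) : PerEq (x + period i) x := by
  classical
  refine ⟨Pi.single i 1, fun j => ?_⟩
  by_cases h : j = i
  · subst h; simp [period]
  · simp [period, h]

lemma isPeriodicTest_expTest (n : Fin d → ℤ) : IsPeriodicTest (expTest n) := by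
  refine ⟨?_, fun x i => ?_⟩
  · have h : ContDiff ℝ ∞ fun x : E d => ∑ i, ((-n) i : ℤ) * x i := by fun_prop
    exact (contDiff_const.mul (Complex.ofRealCLM.contDiff.comp h)).cexp
  · rw [expTest_eq, expTest_eq, toTorus_eq_of_perEq (perEq_add_period x i)]

lemma fderiv_expTest (n : Fin d → ℤ) (x : E d) (i : Fin d) :
    fderiv ℝ (expTest n) x (unitVec i) = -(Complex.I * n i) * expTest n x := by
  have hd : DifferentiableAt ℝ (expTest n) x :=
    ((isPeriodicTest_expTest n).1.differentiable (by simp)).differentiableAt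
  rw [← hd.lineDeriv_eq_fderiv]
  refine HasLineDerivAt.lineDeriv ?_
  have hs : ∀ t : ℝ, ∑ j, ((-n) j : ℤ) * (x + t • unitVec i) j
      = ∑ j, ((-n) j : ℤ) * x j + t * (-n i : ℝ) := by
    intro t
    simp only [PiLp.add_apply, PiLp.smul_apply, unitVec, mul_add, Finset.sum_add_distrib]
    simp [mul_comm]
  have he : ∀ t : ℝ, expTest n (x + t • unitVec i)
      = expTest n x * Complex.exp (-(Complex.I * n i) * t) := by
    intro t
    rw [expTest, hs, expTest, ← Complex.exp_add]
    congr 1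
    push_cast
    ring
  unfold HasLineDerivAt
  simp only [he]
  have h1 : HasDerivAt (fun t : ℝ => -(Complex.I * n i) * (t : ℂ)) (-(Complex.I * n i) * 1) 0 :=
    (Complex.ofRealCLM.hasDerivAt (x := (0 : ℝ))).const_mul _
  refine (h1.cexp.const_mul (expTest n x)).congr_deriv ?_
  rw [Complex.ofReal_zero, mul_zero, Complex.exp_zero]
  ring

lemma integral_mul_expTest (v : L2 d) (n : Fin d → ℤ) :
    ∫ x, v x * expTest n x ∂(cellMeasure d)
      = ((2 * Real.pi) ^ d : ℝ) • torusCoeff (torusFn v) n := by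
  rw [torusCoeff, ← integral_toTorus
    (F := fun t => UnitAddTorus.mFourier (-n) t * torusFn v t) ((UnitAddTorus.mFourier
    (-n)).continuous.stronglyMeasurable.mul (stronglyMeasurable_torusFn v))]
  refine integral_congr_ae ?_
  filter_upwards [perExt_ae_eq v] with x hx
  rw [← hx, expTest_eq, perExt, mul_comm]

/-- Testing the weak gradient against `exp(-i n·x)`. -/
lemma torusCoeff_grad {u : L2 d} {g : Fin d → L2 d} (h : HasPeriodicWeakGradient u g)
    (n : Fin d → ℤ) (i : Fin d) :
    torusCoeff (torusFn (g i)) n = Complex.I * n i * torusCoeff (torusFn u) n := by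
  have e := h _ (isPeriodicTest_expTest n) i
  simp only [fderiv_expTest] at e
  have e1 : ∫ x, u x * (-(Complex.I * n i) * expTest n x) ∂(cellMeasure d)
      = -(Complex.I * n i) * ∫ x, u x * expTest n x ∂(cellMeasure d) := by
    rw [← integral_const_mul]
    congr 1
    ext x
    ring
  rw [e1, integral_mul_expTest, integral_mul_expTest, Complex.real_smul, Complex.real_smul] at e
  have hc : (((2 * Real.pi) ^ d : ℝ) : ℂ) ≠ 0 := by
    exact_mod_cast (pow_pos Real.two_pi_pos d).ne'
  refine mul_left_cancel₀ hc ?_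
  linear_combination e

lemma norm_mFourier_sub_one_sq_le (n : Fin d → ℤ) (z : E d) :
    ‖UnitAddTorus.mFourier n (toTorus z) - 1‖ ^ 2 ≤ ‖z‖ ^ 2 * ∑ i, (n i : ℝ) ^ 2 := by
  rw [mFourier_toTorus]
  calc _ ≤ ‖∑ i, (n i : ℝ) * z i‖ ^ 2 := by
        gcongr
        exact Real.norm_exp_I_mul_ofReal_sub_one_le
    _ = (∑ i, z i * (n i : ℝ)) ^ 2 := by
        rw [Real.norm_eq_abs, sq_abs]
        simp only [mul_comm]
    _ ≤ (∑ i, z i ^ 2) * ∑ i, (n i : ℝ) ^ 2 := Finset.sum_mul_sq_le_sq_mul_sq _ _ _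
    _ = _ := by rw [EuclideanSpace.real_norm_sq_eq]

/-- By Parseval's identity, since `|exp(i n·z) - 1| ≤ |n·z|`. -/
lemma integral_translate_sub_le {u : L2 d} {g : Fin d → L2 d} (h : HasPeriodicWeakGradient u g)
    (z : E d) :
    ∫ t, ‖torusFn u (t + toTorus z) - torusFn u t‖ ^ 2 ∂(torusMeasure d)
      ≤ ‖z‖ ^ 2 * ∑ i, ∫ t, ‖torusFn (g i) t‖ ^ 2 ∂(torusMeasure d) := by
  have h1 := hasSum_torusCoeff_sq ((memLp_translate (memLp_torusFn u) (toTorus z)).sub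
    (memLp_torusFn u))
  have h2 := (hasSum_sum (s := Finset.univ) fun i _ =>
    hasSum_torusCoeff_sq (memLp_torusFn (g i))).mul_left (‖z‖ ^ 2)
  refine hasSum_le (fun n => ?_) h1 h2
  have e := torusCoeff_translate_sub (memLp_torusFn u) (toTorus z) n
  change ‖torusCoeff (fun t => torusFn u (t + toTorus z) - torusFn u t) n‖ ^ 2 ≤ _
  rw [e, norm_mul, mul_pow]
  have e2 : ∑ i, ‖torusCoeff (torusFn (g i)) n‖ ^ 2
      = (∑ i, (n i : ℝ) ^ 2) * ‖torusCoeff (torusFn u) n‖ ^ 2 := by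
    rw [Finset.sum_mul]
    refine Finset.sum_congr rfl fun i _ => ?_
    rw [torusCoeff_grad h, norm_mul, norm_mul, Complex.norm_I, one_mul, mul_pow,
      Complex.norm_intCast, sq_abs]
  rw [e2, ← mul_assoc]
  gcongr
  exact norm_mFourier_sub_one_sq_le n z

lemma lintegral_enorm_sq_eq_ofReal {F : Torus d → ℂ} (hF : MemLp F 2 (torusMeasure d)) :
    ∫⁻ t, ‖F t‖ₑ ^ 2 ∂(torusMeasure d) = ENNReal.ofReal (∫ t, ‖F t‖ ^ 2 ∂(torusMeasure d)) := by
  rw [ofReal_integral_eq_lintegral_ofReal (hF.integrable_norm_pow (by norm_num))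
    (ae_of_all _ fun _ => sq_nonneg _)]
  refine lintegral_congr fun x => ?_
  rw [ENNReal.ofReal_pow (norm_nonneg _), ofReal_norm]

/-- A function in `H¹_P(Ω)`, extended periodically, moves by at most `|z| ‖∇u‖` in `L²(Ω)` under
translation by `z`. -/
theorem lintegral_perExt_translate_sub_le (u : H1P d) (z : E d) :
    ∫⁻ x, ‖perExt u.fn (x + z) - perExt u.fn x‖ₑ ^ 2 ∂(cellMeasure d)
      ≤ ENNReal.ofReal (‖z‖ ^ 2 * u.gradNorm ^ 2) := by
  have hm : Measurable fun t => ‖torusFn u.fn (t + toTorus z) - torusFn u.fn t‖ₑ ^ 2 := by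
    have := (stronglyMeasurable_torusFn u.fn).measurable
    exact ((this.comp (measurable_add_const _)).sub this).enorm.pow_const 2
  simp only [perExt, toTorus_add]
  rw [lintegral_toTorus hm, lintegral_enorm_sq_eq_ofReal
    (F := fun t => torusFn u.fn (t + toTorus z) - torusFn u.fn t)
    ((memLp_translate (memLp_torusFn u.fn) (toTorus z)).sub (memLp_torusFn u.fn))]
  calc _ ≤ ENNReal.ofReal (2 * Real.pi) ^ d * ENNReal.ofReal
        (‖z‖ ^ 2 * ∑ i, ∫ t, ‖torusFn (u.grad i) t‖ ^ 2 ∂(torusMeasure d)) := by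
        gcongr
        exact integral_translate_sub_le u.2 z
    _ = ENNReal.ofReal (‖z‖ ^ 2) * ∑ i, ENNReal.ofReal (‖u.grad i‖ ^ 2) := by
        rw [ENNReal.ofReal_mul (sq_nonneg _), ENNReal.ofReal_sum_of_nonneg
          (fun i _ => integral_nonneg fun _ => sq_nonneg _), mul_left_comm, Finset.mul_sum]
        congr 1
        refine Finset.sum_congr rfl fun i _ => ?_
        rw [← lintegral_enorm_sq_eq_ofReal (memLp_torusFn _), lintegral_torusFn]
    _ = _ := by
        rw [ENNReal.ofReal_mul (sq_nonneg _), gradNorm_sq,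
          ENNReal.ofReal_sum_of_nonneg (fun i _ => sq_nonneg _)]

/-! ### Geometry of the mesh -/

/-- The interior of the periodic cell. -/
def openCell (d : ℕ) : Set (E d) := {x | ∀ i, x i ∈ Set.Ioo (0 : ℝ) (2 * Real.pi)}

lemma isOpen_openCell (d : ℕ) : IsOpen (openCell d) := by
  have h : openCell d = ⋂ i, (fun x : E d => x i) ⁻¹' Set.Ioo (0 : ℝ) (2 * Real.pi) := by
    ext x
    simp [openCell]
  rw [h]
  exact isOpen_iInter_of_finite fun i => isOpen_Ioo.preimage (by fun_prop)

lemma openCell_subset_cell (d : ℕ) : openCell d ⊆ cell d :=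
  fun _ hx i => Set.Ioo_subset_Icc_self (hx i)

lemma cell_subset_closure_openCell (d : ℕ) : cell d ⊆ closure (openCell d) := by
  have h : openCell d = (EuclideanSpace.equiv (Fin d) ℝ).toHomeomorph ⁻¹'
      Set.univ.pi fun _ => Set.Ioo (0 : ℝ) (2 * Real.pi) := by
    ext x
    simp [openCell]
  rw [h, ← Homeomorph.preimage_closure, closure_pi_set]
  intro x hx i _
  rw [closure_Ioo Real.two_pi_pos.ne]
  exact hx i

namespace Mesh

variable (M : Mesh d)

lemma vertex_mem_cell {q : E d} (hq : q ∈ M.complex.vertices) : q ∈ cell d := by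
  rw [← M.space_eq]
  exact M.complex.subset_space hq (by simp)

lemma convexHull_subset_cell {s : Finset (E d)} (hs : s ∈ M.complex.faces) :
    convexHull ℝ (s : Set (E d)) ⊆ cell d := by
  rw [← M.space_eq]
  exact M.complex.convexHull_subset_space hs

lemma mem_vertices_of_mem {s : Finset (E d)} (hs : s ∈ M.complex.faces) {q : E d} (hq : q ∈ s) :
    q ∈ M.complex.vertices :=
  M.complex.down_closed hs (by simpa using hq) (Finset.singleton_nonempty q)

lemma finite_vertices : M.complex.vertices.Finite := by
  refine (M.finite_faces.biUnion (t := fun s => (s : Set (E d)))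
    fun s _ => s.finite_toSet).subset fun q hq => ?_
  exact Set.mem_biUnion (show {q} ∈ M.complex.faces from hq) (by simp)

instance : Finite M.Node :=
  (M.finite_vertices.subset fun _ h => h.1 :
    {p : E d | p ∈ M.complex.vertices ∧ ∀ i, p i < 2 * Real.pi}.Finite).to_subtype

instance : Fintype M.Node := Fintype.ofFinite _

lemma node_eq_of_perEq {q : E d} {p p' : M.Node} (h : PerEq q p.1) (h' : PerEq q p'.1) :
    p = p' := by
  refine Subtype.ext ?_
  obtain ⟨n, hn⟩ := h
  obtain ⟨m, hm⟩ := h'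
  ext i
  have h2 := Real.two_pi_pos
  have a1 := (M.vertex_mem_cell p.2.1 i).1
  have a2 := (M.vertex_mem_cell p'.2.1 i).1
  have b1 := p.2.2 i
  have b2 := p'.2.2 i
  have e : p.1 i - p'.1 i = ((m i - n i : ℤ) : ℝ) * (2 * Real.pi) := by
    push_cast
    linarith [hn i, hm i]
  have c1 : m i - n i < 1 := by
    have : ((m i - n i : ℤ) : ℝ) < 1 := by
      by_contra! hc
      nlinarith
    exact_mod_cast this
  have c2 : -1 < m i - n i := by
    have : (-1 : ℝ) < ((m i - n i : ℤ) : ℝ) := by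
      by_contra! hc
      nlinarith
    exact_mod_cast this
  have c3 : m i - n i = 0 := by omega
  rw [c3] at e
  simpa [sub_eq_zero] using e

/-- Every vertex is identified with a node: translate it by a period for each coordinate equal
to `2π`. -/
lemma exists_node_perEq {q : E d} (hq : q ∈ M.complex.vertices) : ∃ p : M.Node, PerEq q p.1 := by
  classical
  induction h : (Finset.univ.filter fun i => q i = 2 * Real.pi).card using Nat.strong_induction_on
    generalizing q with
  | _ n ih =>
    by_cases hn : ∃ i, q i = 2 * Real.pi
    · obtain ⟨i, hi⟩ := hn
      have hv : q + -period i ∈ M.complex.vertices := by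
        have := M.match_down {q} hq i (by simpa using hi)
        rw [Finset.map_singleton] at this
        exact this
      have hval : ∀ j, (q + -period i) j = if j = i then 0 else q j := by
        intro j
        by_cases hj : j = i
        · subst hj; simp [period, hi]
        · simp [period, hj]
      have hlt : (Finset.univ.filter fun j => (q + -period i) j = 2 * Real.pi).card < n := by
        rw [← h]
        refine Finset.card_lt_card (Finset.ssubset_iff_of_subset ?_ |>.mpr ⟨i, ?_, ?_⟩)
        · intro j
          simp only [Finset.mem_filter, Finset.mem_univ, true_and, hval]
          split_ifs
          · intro h0; exact absurd h0 Real.two_pi_pos.ne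
          · exact id
        · simpa using hi
        · simp [hval]
      obtain ⟨p, m, hm⟩ := ih _ hlt hv rfl
      refine ⟨p, m + Pi.single i 1, fun j => ?_⟩
      have h1 := hm j
      rw [hval] at h1
      by_cases hj : j = i
      · subst hj
        rw [if_pos rfl] at h1
        simp only [Pi.add_apply, Pi.single_eq_same, Int.cast_add, Int.cast_one]
        linarith
      · rw [if_neg hj] at h1
        simpa [hj] using h1
    · push Not at hn
      exact ⟨⟨q, hq, fun i => lt_of_le_of_ne (M.vertex_mem_cell hq i).2 (hn i)⟩, 0,
        fun i => by simp⟩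

/-- The barycentric coordinates of an element of the mesh. -/
def elementBasis {s : Finset (E d)} (hs : s ∈ M.elements) : AffineBasis s ℝ (E d) :=
  ⟨Subtype.val, M.complex.indep hs.1, by
    have h := (M.complex.indep hs.1).affineSpan_eq_top_iff_card_eq_finrank_add_one
    rw [h, Fintype.card_coe, hs.2, finrank_euclideanSpace_fin]⟩

lemma coord_eq_of_isBarycentric {s : Finset (E d)} (hs : s ∈ M.elements) {w : E d → ℝ} {x : E d}
    (hw : IsBarycentric s w x) (q : s) : (M.elementBasis hs).coord q x = w q := by
  have h1 : ∑ q : s, w q = 1 := by rw [Finset.sum_coe_sort s w, hw.2.1]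
  have h2 := (M.elementBasis hs).coord_apply_combination_of_mem (Finset.mem_univ q) h1
  rw [Finset.affineCombination_eq_linear_combination _ _ _ h1] at h2
  rw [← h2, ← hw.2.2, ← Finset.sum_coe_sort s (fun q => w q • q)]
  rfl

/-- On an element, the affine function with prescribed values at the vertices. -/
lemma exists_continuous_eq_sum {s : Finset (E d)} (hs : s ∈ M.elements) (c : E d → ℂ) :
    ∃ L : E d → ℂ, Continuous L ∧ ∀ w x, IsBarycentric s w x → L x = ∑ q ∈ s, (w q : ℂ) * c q := by
  refine ⟨fun x => ∑ q : s, ((M.elementBasis hs).coord q x : ℂ) * c q, ?_, fun w x hw => ?_⟩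
  · refine continuous_finsetSum _ fun q _ => ?_
    exact (Complex.continuous_ofReal.comp
      (continuous_barycentric_coord (M.elementBasis hs) q)).mul continuous_const
  · simp only [M.coord_eq_of_isBarycentric hs hw]
    exact Finset.sum_coe_sort s (fun q => (w q : ℂ) * c q)

lemma exists_isBarycentric {s : Finset (E d)} {x : E d}
    (hx : x ∈ convexHull ℝ (s : Set (E d))) : ∃ w, IsBarycentric s w x := by
  obtain ⟨w, h0, h1, h2⟩ := Finset.mem_convexHull'.mp hx
  exact ⟨w, h0, h1, h2⟩

open Classical in
lemma isBarycentric_vertex {s : Finset (E d)} {q : E d} (hq : q ∈ s) :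
    IsBarycentric s (fun r => if r = q then 1 else 0) q := by
  refine ⟨fun r _ => by dsimp only; split_ifs <;> norm_num, by simp [hq], by simp [hq]⟩

lemma isCompact_convexHull (s : Finset (E d)) : IsCompact (convexHull ℝ (s : Set (E d))) :=
  s.finite_toSet.isCompact_convexHull (𝕜 := ℝ)

lemma volume_convexHull_eq_zero {s : Finset (E d)} (hs : s ∈ M.complex.faces)
    (hs' : s ∉ M.elements) : volume (convexHull ℝ (s : Set (E d))) = 0 := by
  refine measure_mono_null (convexHull_subset_affineSpan _) ?_
  refine Measure.addHaar_affineSubspace _ _ fun h => hs' ⟨hs, ?_⟩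
  have h' := (M.complex.indep hs).affineSpan_eq_top_iff_card_eq_finrank_add_one
  rw [Fintype.card_coe, finrank_euclideanSpace_fin] at h'
  refine h'.mp ?_
  rw [← h]
  congr 1
  ext
  simp

lemma finite_elements : M.elements.Finite := M.finite_faces.subset fun _ h => h.1

/-- The mesh is pure: the lower-dimensional faces have measure zero, so that the elements, whose
union is closed, cover the whole cell. -/
lemma exists_element_mem {x : E d} (hx : x ∈ cell d) :
    ∃ s ∈ M.elements, x ∈ convexHull ℝ (s : Set (E d)) := by
  set U : Set (E d) := ⋃ s ∈ M.elements, convexHull ℝ (s : Set (E d)) with hU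
  have hUc : IsClosed U :=
    M.finite_elements.isClosed_biUnion fun s _ => (isCompact_convexHull s).isClosed
  have hnull : volume (cell d \ U) = 0 := by
    refine measure_mono_null (t := ⋃ s ∈ M.complex.faces \ M.elements,
      convexHull ℝ (s : Set (E d))) ?_ ?_
    · rintro y ⟨hy, hyU⟩
      rw [← M.space_eq, M.complex.mem_space_iff] at hy
      obtain ⟨s, hs, hys⟩ := hy
      refine Set.mem_biUnion (⟨hs, fun hs' => hyU ?_⟩ : s ∈ M.complex.faces \ M.elements) hys
      exact Set.mem_biUnion hs' hys
    · refine (measure_biUnion_null_iff (M.finite_faces.subset Set.sdiff_subset).countable).mpr ?_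
      exact fun s hs => M.volume_convexHull_eq_zero hs.1 hs.2
  have hO : openCell d \ U = ∅ := by
    by_contra hne
    have hpos := (isOpen_openCell d |>.sdiff hUc).measure_pos volume
      (Set.nonempty_iff_ne_empty.mpr hne)
    exact hpos.ne' (measure_mono_null
      (Set.sdiff_subset_sdiff_left (openCell_subset_cell d)) hnull)
  have hsub : cell d ⊆ U := (cell_subset_closure_openCell d).trans
    (hUc.closure_subset_iff.mpr (Set.sdiff_eq_empty.mp hO))
  simpa [hU] using hsub hx

lemma exists_element_vertex {q : E d} (hq : q ∈ M.complex.vertices) :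
    ∃ s ∈ M.elements, q ∈ s := by
  obtain ⟨s, hs, hqs⟩ := M.exists_element_mem (M.vertex_mem_cell hq)
  refine ⟨s, hs, ?_⟩
  have h := M.complex.inter_subset_convexHull hs.1 hq ⟨hqs, by simp⟩
  by_contra hn
  have : (s : Set (E d)) ∩ (({q} : Finset (E d)) : Set (E d)) = ∅ := by simpa using hn
  rw [this] at h
  simp at h

lemma dist_le_meshSize {s : Finset (E d)} (hs : s ∈ M.elements) {x q : E d}
    (hx : x ∈ convexHull ℝ (s : Set (E d))) (hq : q ∈ s) : dist x q ≤ M.meshSize := by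
  refine (Metric.dist_le_diam_of_mem (isCompact_convexHull s).isBounded hx
    (subset_convexHull ℝ _ hq)).trans ?_
  exact le_csSup (M.finite_elements.image _).bddAbove ⟨s, hs, rfl⟩

lemma meshSize_pos (hd : 0 < d) : 0 < M.meshSize := by
  obtain ⟨s, hs, -⟩ := M.exists_element_mem (x := 0) fun i => ⟨le_rfl, Real.two_pi_pos.le⟩
  have hcard : 1 < s.card := by rw [hs.2]; omega
  obtain ⟨p, hp, q, hq, hpq⟩ := Finset.one_lt_card.mp hcard
  exact (dist_pos.mpr hpq).trans_le (M.dist_le_meshSize hs (subset_convexHull ℝ _ hp) hq)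

/-! ### Finite element functions -/

/-- The finite element function with nodal values `c`. -/
def feFn (c : M.Node → ℂ) (x : E d) : ℂ := ∑ p, c p * (M.hat p x : ℂ)

open Classical in
/-- The periodic extension of nodal values to all vertices; a vertex is identified with exactly one
node, so that the sum has a single term. -/
def vertexValue (c : M.Node → ℂ) (q : E d) : ℂ := ∑ p with PerEq q p.1, c p

lemma vertexValue_eq (c : M.Node → ℂ) {q : E d} {p : M.Node} (h : PerEq q p.1) :
    M.vertexValue c q = c p := by
  classical
  rw [vertexValue, Finset.sum_eq_single p]
  · exact fun p' hp' hne => absurd (M.node_eq_of_perEq (Finset.mem_filter.mp hp').2 h) hne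
  · exact fun hp => absurd (by simpa using h) hp

lemma feFn_eq (c : M.Node → ℂ) {s : Finset (E d)} (hs : s ∈ M.complex.faces) {w : E d → ℝ}
    {x : E d} (hw : IsBarycentric s w x) :
    M.feFn c x = ∑ q ∈ s, (w q : ℂ) * M.vertexValue c q := by
  classical
  simp only [feFn, M.hat_eq _ hs hw, vertexValue, Complex.ofReal_sum, Finset.mul_sum,
    Finset.sum_filter]
  rw [Finset.sum_comm]
  refine Finset.sum_congr rfl fun q _ => Finset.sum_congr rfl fun p _ => ?_
  split_ifs
  · ring
  · simp

lemma exists_continuous_eqOn_feFn (c : M.Node → ℂ) {s : Finset (E d)} (hs : s ∈ M.elements) :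
    ∃ L : E d → ℂ, Continuous L ∧ Set.EqOn (M.feFn c) L (convexHull ℝ (s : Set (E d))) := by
  obtain ⟨L, hL, h⟩ := M.exists_continuous_eq_sum hs (M.vertexValue c)
  refine ⟨L, hL, fun x hx => ?_⟩
  obtain ⟨w, hw⟩ := exists_isBarycentric hx
  rw [h w x hw, M.feFn_eq c hs.1 hw]

lemma continuousOn_feFn (c : M.Node → ℂ) {s : Finset (E d)} (hs : s ∈ M.elements) :
    ContinuousOn (M.feFn c) (convexHull ℝ (s : Set (E d))) := by
  obtain ⟨L, hL, h⟩ := M.exists_continuous_eqOn_feFn c hs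
  exact hL.continuousOn.congr h

lemma cell_eq_iUnion_elements :
    cell d = ⋃ s : M.elements, convexHull ℝ ((s : Finset (E d)) : Set (E d)) := by
  refine Set.Subset.antisymm (fun x hx => ?_) (Set.iUnion_subset fun s =>
    M.convexHull_subset_cell s.2.1)
  obtain ⟨s, hs, h⟩ := M.exists_element_mem hx
  exact Set.mem_iUnion.mpr ⟨⟨s, hs⟩, h⟩

lemma continuousOn_feFn_cell (c : M.Node → ℂ) : ContinuousOn (M.feFn c) (cell d) := by
  have := M.finite_elements.to_subtype
  rw [M.cell_eq_iUnion_elements]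
  exact (locallyFinite_of_finite _).continuousOn_iUnion
    (fun s => (isCompact_convexHull _).isClosed) fun s => M.continuousOn_feFn c s.2

lemma memLp_feFn (c : M.Node → ℂ) : MemLp (M.feFn c) 2 (cellMeasure d) := by
  have hc := M.continuousOn_feFn_cell c
  obtain ⟨b, hb⟩ := (isCompact_cell d).exists_bound_of_continuousOn hc
  exact MemLp.of_bound (hc.aestronglyMeasurable (measurableSet_cell d)) b
    ((ae_restrict_mem (measurableSet_cell d)).mono hb)

/-- A finite element function that vanishes almost everywhere has nodal values zero. -/
lemma eq_zero_of_feFn_ae_eq_zero (c : M.Node → ℂ)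
    (h : ∀ᵐ x, x ∈ openCell d → M.feFn c x = 0) : c = 0 := by
  have hcell : Set.EqOn (M.feFn c) 0 (cell d) := by
    have h0 := Measure.eqOn_open_of_ae_eq (μ := volume) (g := 0)
      ((ae_restrict_iff' (isOpen_openCell d).measurableSet).mpr h) (isOpen_openCell d)
      ((M.continuousOn_feFn_cell c).mono (openCell_subset_cell d)) continuousOn_const
    exact h0.of_subset_closure (M.continuousOn_feFn_cell c) continuousOn_const
      (openCell_subset_cell d) (cell_subset_closure_openCell d)
  ext p
  have hp := hcell (M.vertex_mem_cell p.2.1)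
  obtain ⟨s, hs, hps⟩ := M.exists_element_vertex p.2.1
  classical
  rw [M.feFn_eq c hs.1 (isBarycentric_vertex hps), Finset.sum_eq_single p.1
    (fun q _ hq => by simp [hq]) (fun h => absurd hps h)] at hp
  simpa [M.vertexValue_eq c (⟨0, fun i => by simp⟩ : PerEq p.1 p.1)] using hp

end Mesh

/-! ### Approximation by finite element functions -/

/-- Jensen's inequality for the distance of a mean value to a constant. -/
lemma enorm_sub_integral_sq_le {α : Type*} [MeasurableSpace α] (ν : Measure α)
    [IsProbabilityMeasure ν] {f : α → ℂ} (hf : AEStronglyMeasurable f ν) (a : ℂ) :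
    ‖a - ∫ z, f z ∂ν‖ₑ ^ 2 ≤ ∫⁻ z, ‖f z - a‖ₑ ^ 2 ∂ν := by
  by_cases htop : ∫⁻ z, ‖f z - a‖ₑ ^ 2 ∂ν = ⊤
  · rw [htop]
    exact le_top
  have hg : AEStronglyMeasurable (fun z => f z - a) ν := hf.sub aestronglyMeasurable_const
  have h2 : eLpNorm (fun z => f z - a) 2 ν ^ 2 = ∫⁻ z, ‖f z - a‖ₑ ^ 2 ∂ν := by
    have := eLpNorm_nnreal_pow_eq_lintegral (f := fun z => f z - a) (μ := ν) (p := 2) (by norm_num)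
    simpa using this
  have hmem : MemLp (fun z => f z - a) 2 ν := by
    refine ⟨hg, lt_top_iff_ne_top.mpr fun h => htop ?_⟩
    rw [← h2, h]
    rfl
  have hint : Integrable (fun z => f z - a) ν := hmem.integrable (by norm_num)
  have hfi : Integrable f ν := 
    (hint.add (integrable_const a)).congr (ae_of_all _ fun z => by simp)
  have e : ∫ z, f z ∂ν - a = ∫ z, (f z - a) ∂ν := by
    rw [integral_sub hfi (integrable_const a)]
    simp
  rw [← h2, ← enorm_neg, neg_sub, e]
  gcongr
  calc ‖∫ z, (f z - a) ∂ν‖ₑ ≤ ∫⁻ z, ‖f z - a‖ₑ ∂ν := enorm_integral_le_lintegral_enorm _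
    _ = eLpNorm (fun z => f z - a) 1 ν := eLpNorm_one_eq_lintegral_enorm.symm
    _ ≤ eLpNorm (fun z => f z - a) 2 ν :=
        eLpNorm_le_eLpNorm_of_exponent_le (by norm_num) hg

/-- The mean value over the ball of radius `r` about `q` of the periodic extension of `v`. -/
def ballMean (v : L2 d) (r : ℝ) (q : E d) : ℂ :=
  ∫ z, perExt v (q + z) ∂(ProbabilityTheory.cond volume (Metric.closedBall (0 : E d) r))

/-- The mean square oscillation of the periodic extension of `v` about `x`: the integral over the
ball of radius `2r`, relative to the volume of the ball of radius `r`. -/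
def oscillation (v : L2 d) (r : ℝ) (x : E d) : ENNReal :=
  (volume (Metric.closedBall (0 : E d) r))⁻¹ *
    ∫⁻ z in Metric.closedBall (0 : E d) (2 * r), ‖perExt v (x + z) - perExt v x‖ₑ ^ 2

/-- If `|x - q| ≤ r`, then the ball of radius `r` about `q` lies in the ball of radius `2r` about
`x`, so the mean about `q` deviates from the value at `x` by no more than the oscillation about `x`,
which does not depend on `q`. -/
lemma enorm_sub_ballMean_sq_le (v : L2 d) {r : ℝ} (hr : 0 < r) {x q : E d} (hxq : dist x q ≤ r) :
    ‖perExt v x - ballMean v r q‖ₑ ^ 2 ≤ oscillation v r x := by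
  have hball : volume (Metric.closedBall (0 : E d) r) ≠ 0 :=
    (Metric.measure_closedBall_pos volume _ hr).ne'
  have : IsProbabilityMeasure
      (ProbabilityTheory.cond volume (Metric.closedBall (0 : E d) r)) :=
    ProbabilityTheory.cond_isProbabilityMeasure_of_finite hball measure_closedBall_lt_top.ne
  have hm : Measurable (perExt v) := (stronglyMeasurable_perExt v).measurable
  refine (enorm_sub_integral_sq_le _
    (hm.comp (measurable_const_add q)).aestronglyMeasurable _).trans ?_
  rw [ProbabilityTheory.cond, lintegral_smul_measure, smul_eq_mul, oscillation]
  gcongr 1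
  have hpre : Metric.closedBall (0 : E d) r
      = (fun z => (q - x) + z) ⁻¹' Metric.closedBall (q - x) r := by
    ext z
    simp [dist_eq_norm]
  have e : ∀ z, q + z = x + ((q - x) + z) := fun z => by abel
  simp only [Function.comp_apply, e]
  rw [hpre, (measurePreserving_add_left volume (q - x)).setLIntegral_comp_preimage
    (f := fun z => ‖perExt v (x + z) - perExt v x‖ₑ ^ 2) measurableSet_closedBall
    (((hm.comp (measurable_const_add x)).sub_const _).enorm.pow_const 2)]
  refine lintegral_mono_set (Metric.closedBall_subset_closedBall' ?_)
  rw [dist_zero_right, ← dist_eq_norm, dist_comm]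
  linarith

/-- By Tonelli's theorem and the translation estimate; `2^d` is the ratio of the volumes of the two
balls. -/
lemma lintegral_oscillation_le (v : H1P d) {r : ℝ} (hr : 0 < r) :
    ∫⁻ x, oscillation v.fn r x ∂(cellMeasure d)
      ≤ ENNReal.ofReal ((2 ^ (d + 1) * r * v.gradNorm) ^ 2) := by
  have hm : Measurable (perExt v.fn) := (stronglyMeasurable_perExt v.fn).measurable
  have hball : volume (Metric.closedBall (0 : E d) r) ≠ 0 :=
    (Metric.measure_closedBall_pos volume _ hr).ne'
  have hball' : volume (Metric.closedBall (0 : E d) r) ≠ ⊤ := measure_closedBall_lt_top.ne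
  have hm2 : Measurable fun p : E d × E d =>
      ‖perExt v.fn (p.1 + p.2) - perExt v.fn p.1‖ₑ ^ 2 :=
    ((hm.comp (measurable_fst.add measurable_snd)).sub (hm.comp measurable_fst)).enorm.pow_const 2
  simp only [oscillation]
  rw [lintegral_const_mul _ (Measurable.lintegral_prod_right' hm2),
    lintegral_lintegral_swap hm2.aemeasurable]
  have hz : ∀ z ∈ Metric.closedBall (0 : E d) (2 * r),
      ∫⁻ x, ‖perExt v.fn (x + z) - perExt v.fn x‖ₑ ^ 2 ∂(cellMeasure d)
        ≤ ENNReal.ofReal ((2 * r) ^ 2 * v.gradNorm ^ 2) := fun z hz => by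
    refine (lintegral_perExt_translate_sub_le v z).trans ?_
    gcongr
    simpa using hz
  calc _ ≤ (volume (Metric.closedBall (0 : E d) r))⁻¹ *
        ∫⁻ _ in Metric.closedBall (0 : E d) (2 * r),
          ENNReal.ofReal ((2 * r) ^ 2 * v.gradNorm ^ 2) := by
        gcongr 1
        exact setLIntegral_mono measurable_const hz
    _ = ENNReal.ofReal (2 ^ d) * ENNReal.ofReal ((2 * r) ^ 2 * v.gradNorm ^ 2) := by
        rw [setLIntegral_const, Measure.addHaar_closedBall_mul _ _ (by norm_num) hr.le,
          finrank_euclideanSpace_fin]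
        rw [show ∀ a b c : ENNReal, a⁻¹ * (b * (c * a)) = c * b * (a⁻¹ * a) from
          fun a b c => by ring, ENNReal.inv_mul_cancel hball hball', mul_one]
    _ ≤ _ := by
        rw [← ENNReal.ofReal_mul (by positivity)]
        refine ENNReal.ofReal_le_ofReal ?_
        have h1 : (1 : ℝ) ≤ 2 ^ d := one_le_pow₀ (by norm_num)
        calc (2 : ℝ) ^ d * ((2 * r) ^ 2 * v.gradNorm ^ 2)
            ≤ (2 ^ d * 2 ^ d) * ((2 * r) ^ 2 * v.gradNorm ^ 2) := by
              gcongr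
              exact le_mul_of_one_le_left (by positivity) h1
          _ = _ := by ring

namespace Mesh

variable (M : Mesh d)

/-- Quasi-interpolation: the nodal values are the mean values over the balls of radius `H` about
the nodes. -/
def quasiInterpolant (v : L2 d) (p : M.Node) : ℂ := ballMean v M.meshSize p.1

lemma vertexValue_quasiInterpolant (v : L2 d) {q : E d} (hq : q ∈ M.complex.vertices) :
    M.vertexValue (M.quasiInterpolant v) q = ballMean v M.meshSize q := by
  obtain ⟨p, hp⟩ := M.exists_node_perEq hq
  rw [M.vertexValue_eq _ hp, quasiInterpolant, ballMean, ballMean]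
  simp only [perExt_add_eq_of_perEq v hp]

/-- The value of the quasi-interpolant at `x` is a convex combination of mean values about vertices
at distance at most `H` from `x`. -/
lemma enorm_sub_quasiInterpolant_sq_le (hd : 0 < d) (v : L2 d) {x : E d} (hx : x ∈ cell d) :
    ‖perExt v x - M.feFn (M.quasiInterpolant v) x‖ₑ ^ 2 ≤ oscillation v M.meshSize x := by
  obtain ⟨s, hs, hxs⟩ := M.exists_element_mem hx
  obtain ⟨w, hw⟩ := exists_isBarycentric hxs
  have hne : s.Nonempty := M.complex.nonempty_of_mem_faces hs.1
  obtain ⟨q, hq, hmax⟩ :=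
    s.exists_max_image (fun q => ‖perExt v x - ballMean v M.meshSize q‖) hne
  have hsum : perExt v x - M.feFn (M.quasiInterpolant v) x
      = ∑ q ∈ s, (w q : ℂ) * (perExt v x - ballMean v M.meshSize q) := by
    rw [M.feFn_eq _ hs.1 hw]
    simp only [mul_sub, Finset.sum_sub_distrib, ← Finset.sum_mul, ← Complex.ofReal_sum, hw.2.1,
      Complex.ofReal_one, one_mul]
    congr 1
    exact Finset.sum_congr rfl fun q hq => by
      rw [M.vertexValue_quasiInterpolant v (M.mem_vertices_of_mem hs.1 hq)]
  have hle : ‖perExt v x - M.feFn (M.quasiInterpolant v) x‖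
      ≤ ‖perExt v x - ballMean v M.meshSize q‖ := by
    rw [hsum]
    calc _ ≤ ∑ r ∈ s, w r * ‖perExt v x - ballMean v M.meshSize q‖ := by
          refine norm_sum_le_of_le _ fun r hr => ?_
          rw [norm_mul, Complex.norm_real, Real.norm_of_nonneg (hw.1 r hr)]
          exact mul_le_mul_of_nonneg_left (hmax r hr) (hw.1 r hr)
      _ = _ := by rw [← Finset.sum_mul, hw.2.1, one_mul]
  calc _ ≤ ‖perExt v x - ballMean v M.meshSize q‖ₑ ^ 2 := by
        gcongr
        exact enorm_le_iff_norm_le.mpr hle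
    _ ≤ _ := enorm_sub_ballMean_sq_le v (M.meshSize_pos hd) (M.dist_le_meshSize hs hxs hq)

/-- First-order approximation by finite element functions, with a constant that depends on the
dimension only. -/
theorem exists_norm_sub_feFn_le (hd : 0 < d) (v : H1P d) :
    ∃ c : M.Node → ℂ, ‖v.fn - (M.memLp_feFn c).toLp‖ ≤ 2 ^ (d + 1) * M.meshSize * v.gradNorm := by
  refine ⟨M.quasiInterpolant v.fn, ?_⟩
  set g := (M.memLp_feFn (M.quasiInterpolant v.fn)).toLp with hg
  have hpos := M.meshSize_pos hd
  have hnn : 0 ≤ 2 ^ (d + 1) * M.meshSize * v.gradNorm :=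
    mul_nonneg (by positivity) (gradNorm_nonneg v)
  refine le_of_sq_le_sq ?_ hnn
  refine (ENNReal.ofReal_le_ofReal_iff (sq_nonneg _)).mp ?_
  rw [← lintegral_enorm_sq]
  refine le_trans (lintegral_mono_ae ?_) (lintegral_oscillation_le v hpos)
  filter_upwards [Lp.coeFn_sub v.fn g, perExt_ae_eq v.fn, (M.memLp_feFn
    (M.quasiInterpolant v.fn)).coeFn_toLp, ae_restrict_mem (measurableSet_cell d)] with x h1 h2 h3 h4
  rw [h1, Pi.sub_apply, hg, h3, ← h2]
  exact M.enorm_sub_quasiInterpolant_sq_le hd v.fn h4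

end Mesh

/-! ### Completeness of `H¹_P(Ω)` -/

lemma integral_mul_eq_inner (w : L2 d) {h : E d → ℂ} (hh : MemLp h 2 (cellMeasure d)) :
    ∫ x, w x * h x ∂(cellMeasure d) = inner ℂ hh.star.toLp w := by
  rw [L2.inner_def]
  refine integral_congr_ae ?_
  filter_upwards [hh.star.coeFn_toLp] with x hx
  rw [hx, RCLike.inner_apply]
  simp

lemma memLp_of_continuous {h : E d → ℂ} (hh : Continuous h) : MemLp h 2 (cellMeasure d) := by
  obtain ⟨b, hb⟩ := (isCompact_cell d).exists_bound_of_continuousOn hh.continuousOn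
  exact MemLp.of_bound hh.aestronglyMeasurable b
    ((ae_restrict_mem (measurableSet_cell d)).mono hb)

lemma isClosed_gradGraph (d : ℕ) : IsClosed (gradGraph d : Set (L2 d × (Fin d → L2 d))) := by
  have h : (gradGraph d : Set (L2 d × (Fin d → L2 d))) = ⋂ (φ : {φ : E d → ℂ // IsPeriodicTest φ}),
      ⋂ i, {p | ∫ x, p.1 x * fderiv ℝ φ.1 x (unitVec i) ∂(cellMeasure d)
        = -∫ x, p.2 i x * φ.1 x ∂(cellMeasure d)} := by
    ext p
    simp only [Set.mem_iInter, Subtype.forall]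
    rfl
  rw [h]
  refine isClosed_iInter fun φ => isClosed_iInter fun i => ?_
  have hc : Continuous φ.1 := φ.2.1.continuous
  have hc' : Continuous fun x => fderiv ℝ φ.1 x (unitVec i) :=
    (φ.2.1.continuous_fderiv (by simp)).clm_apply continuous_const
  simp only [integral_mul_eq_inner _ (memLp_of_continuous hc),
    integral_mul_eq_inner _ (memLp_of_continuous hc')]
  exact isClosed_eq (by fun_prop) (by fun_prop)

instance : CompleteSpace (H1P d) := (isClosed_gradGraph d).completeSpace_coe

/-! ### Test functions in `H¹_P(Ω)` -/

lemma setIntegral_cell_eq {F : E d → ℂ} (hF : ∀ x ∉ openCell d, F x = 0) :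
    ∫ x, F x ∂(cellMeasure d) = ∫ x, F x :=
  setIntegral_eq_integral_of_forall_compl_eq_zero fun x hx =>
    hF x fun h => hx (openCell_subset_cell d h)

/-- A smooth function with compact support in the interior of the cell belongs to `H¹_P(Ω)`. -/
lemma exists_H1P_eq {g : E d → ℝ} (hg : ContDiff ℝ ∞ g) (hgc : HasCompactSupport g)
    (hgs : tsupport g ⊆ openCell d) :
    ∃ v : H1P d, v.fn =ᵐ[cellMeasure d] fun x => (g x : ℂ) := by
  set G : E d → ℂ := fun x => (g x : ℂ) with hG
  have hGs : ContDiff ℝ ∞ G := Complex.ofRealCLM.contDiff.comp hg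
  have hGc : HasCompactSupport G := hgc.comp_left Complex.ofReal_zero
  have hG0 : ∀ x ∉ openCell d, G x = 0 := fun x hx => by
    have h0 : g x = 0 := image_eq_zero_of_notMem_tsupport fun h => hx (hgs h)
    simp only [hG, h0, Complex.ofReal_zero]
  have hGt : tsupport G ⊆ openCell d :=
    (closure_mono (Function.support_comp_subset Complex.ofReal_zero g)).trans hgs
  let D : Fin d → E d → ℂ := fun i x => fderiv ℝ G x (unitVec i)
  have hDc : ∀ i, Continuous (D i) := fun i =>
    (hGs.continuous_fderiv (by simp)).clm_apply continuous_const
  have hDs : ∀ i, HasCompactSupport (D i) := fun i => hGc.fderiv_apply (𝕜 := ℝ) _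
  have hD0 : ∀ i, ∀ x ∉ openCell d, D i x = 0 := fun i x hx => by
    have : fderiv ℝ G x = 0 := image_eq_zero_of_notMem_tsupport fun h =>
      hx (hGt (tsupport_fderiv_subset ℝ h))
    simp [D, this]
  refine ⟨⟨((memLp_of_continuous hGs.continuous).toLp,
    fun i => (memLp_of_continuous (hDc i)).toLp), ?_⟩,
    (memLp_of_continuous hGs.continuous).coeFn_toLp⟩
  intro φ hφ i
  have hφc : Continuous φ := hφ.1.continuous
  have hφc' : Continuous fun x => fderiv ℝ φ x (unitVec i) :=
    (hφ.1.continuous_fderiv (by simp)).clm_apply continuous_const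
  have e1 : ∫ x, (memLp_of_continuous hGs.continuous).toLp G x * fderiv ℝ φ x (unitVec i)
      ∂(cellMeasure d) = ∫ x, G x * fderiv ℝ φ x (unitVec i) := by
    rw [← setIntegral_cell_eq fun x hx => by rw [hG0 x hx, zero_mul]]
    refine integral_congr_ae ?_
    filter_upwards [(memLp_of_continuous hGs.continuous).coeFn_toLp] with x hx
    rw [hx]
  have e2 : ∫ x, (memLp_of_continuous (hDc i)).toLp (D i) x * φ x ∂(cellMeasure d)
      = ∫ x, D i x * φ x := by
    rw [← setIntegral_cell_eq fun x hx => by rw [hD0 i x hx, zero_mul]]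
    refine integral_congr_ae ?_
    filter_upwards [(memLp_of_continuous (hDc i)).coeFn_toLp] with x hx
    rw [hx]
  rw [e1, e2]
  exact integral_mul_fderiv_eq_neg_fderiv_mul_of_integrable
    (((hDc i).mul hφc).integrable_of_hasCompactSupport (hDs i).mul_right)
    ((hGs.continuous.mul hφc').integrable_of_hasCompactSupport hGc.mul_right)
    ((hGs.continuous.mul hφc).integrable_of_hasCompactSupport hGc.mul_right)
    (fun x _ => (hGs.differentiable (by simp)) x) (fun x _ => (hφ.1.differentiable (by simp)) x)

/-! ### Moments -/

namespace Mesh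

variable (M : Mesh d)

lemma feFn_single [DecidableEq M.Node] (k : M.Node) (x : E d) :
    M.feFn (Pi.single k 1) x = (M.hat k x : ℂ) := by
  simp [feFn, Pi.single_apply]

lemma memLp_hat (k : M.Node) : MemLp (fun x => (M.hat k x : ℂ)) 2 (cellMeasure d) := by
  classical
  refine (M.memLp_feFn (Pi.single k 1)).ae_eq (ae_of_all _ fun x => M.feFn_single k x)

lemma integral_mul_feFn (w : H1P d) (c : M.Node → ℂ) :
    ∫ x, w.fn x * M.feFn c x ∂(cellMeasure d) = ∑ k, c k * moment M w k := by
  simp only [moment, ← integral_const_mul, feFn, Finset.mul_sum]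
  rw [← integral_finsetSum]
  · refine integral_congr_ae (ae_of_all _ fun x => Finset.sum_congr rfl fun k _ => ?_)
    ring
  · intro k _
    exact ((Lp.memLp w.fn).integrable_mul (M.memLp_hat k)).const_mul _

lemma conj_feFn (c : M.Node → ℂ) (x : E d) :
    conj (M.feFn c x) = M.feFn (fun k => conj (c k)) x := by
  simp [feFn]

/-- A function with vanishing moments is `L²`-orthogonal to the finite element functions. -/
lemma inner_feFn_eq_zero {w : H1P d} (hw : ∀ k, moment M w k = 0) (c : M.Node → ℂ) :
    inner ℂ (M.memLp_feFn c).toLp w.fn = 0 := by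
  rw [L2.inner_def]
  have h := M.integral_mul_feFn w fun k => conj (c k)
  simp only [hw, mul_zero, Finset.sum_const_zero] at h
  rw [← h]
  refine integral_congr_ae ?_
  filter_upwards [(M.memLp_feFn c).coeFn_toLp] with x hx
  rw [hx, RCLike.inner_apply, conj_feFn]

/-- The moments against the nodal basis functions, as a continuous linear map on `H¹_P(Ω)`. -/
def momentCLM : H1P d →L[ℂ] (M.Node → ℂ) :=
  ContinuousLinearMap.pi fun k => (innerSL ℂ (M.memLp_hat k).star.toLp).comp
    ((ContinuousLinearMap.fst ℂ (L2 d) (Fin d → L2 d)).comp (gradGraph d).subtypeL)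

lemma momentCLM_apply (w : H1P d) (k : M.Node) : M.momentCLM w k = moment M w k :=
  (integral_mul_eq_inner w.fn (M.memLp_hat k)).symm

/-- The nodal basis functions are linearly independent and the test functions are dense, so the
moments can be prescribed. -/
lemma surjective_momentCLM : Function.Surjective M.momentCLM := by
  classical
  refine LinearMap.range_eq_top (f := (M.momentCLM : H1P d →ₗ[ℂ] (M.Node → ℂ))).mp ?_
  by_contra hne
  obtain ⟨f, hf0, hf⟩ := Submodule.exists_le_ker_of_lt_top _ (lt_top_iff_ne_top.mpr hne)
  set c : M.Node → ℂ := fun k => f (Pi.single k 1) with hc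
  have hfc : ∀ y, f y = ∑ k, c k * y k := fun y => by
    rw [LinearMap.pi_apply_eq_sum_univ f y]
    refine Finset.sum_congr rfl fun k _ => ?_
    rw [smul_eq_mul, mul_comm, hc]
    congr 2
    ext j
    simp [Pi.single_apply, eq_comm]
  have hc0 : c = 0 := by
    refine M.eq_zero_of_feFn_ae_eq_zero c ?_
    refine (isOpen_openCell d).ae_eq_zero_of_integral_contDiff_smul_eq_zero ?_ ?_
    · have hint : IntegrableOn (M.feFn c) (cell d) volume :=
        (M.memLp_feFn c).integrable (by norm_num)
      exact (hint.mono_set (openCell_subset_cell d)).locallyIntegrableOn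
    · intro g hg hgc hgs
      obtain ⟨v, hv⟩ := exists_H1P_eq hg hgc hgs
      rw [← setIntegral_cell_eq fun x hx => by
        rw [image_eq_zero_of_notMem_tsupport fun h => hx (hgs h), zero_smul]]
      have h1 : f (M.momentCLM v) = 0 := hf ⟨v, rfl⟩
      rw [hfc] at h1
      simp only [momentCLM_apply] at h1
      rw [← M.integral_mul_feFn] at h1
      rw [← h1]
      refine integral_congr_ae ?_
      filter_upwards [hv] with x hx
      rw [hx, Complex.real_smul]
  exact hf0 (LinearMap.ext fun y => by simp [hfc, hc0])

end Mesh

/-! ### Error estimates -/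

namespace IsPotential

variable {V : E d → ℝ} {a b : ℝ}

lemma form_sub_left (hV : IsPotential V a b) (ε : ℝ) (u v w : H1P d) :
    form ε V (u - v) w = form ε V u w - form ε V v w := by
  rw [sub_eq_add_neg, hV.form_add_left, ← neg_one_smul ℂ v, form_smul_left]
  ring

variable {ε : ℝ} {M : Mesh d} {f : L2 d} {u uH : H1P d}

lemma form_error_eq_zero (hV : IsPotential V a b) (hu : IsWeakSolution ε V f u)
    (huH : IsGalerkinSolution ε V f (globalSpace ε V M) uH) {ψ : H1P d}
    (hψ : ψ ∈ globalSpace ε V M) : form ε V (u - uH) ψ = 0 := by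
  rw [hV.form_sub_left, hu, huH.2 ψ hψ, sub_self]

/-- The Galerkin error is `L²`-orthogonal to the nodal basis functions. -/
lemma moment_error_eq_zero (hV : IsPotential V a b) (hε : 0 < ε) (hu : IsWeakSolution ε V f u)
    (huH : IsGalerkinSolution ε V f (globalSpace ε V M) uH) (k : M.Node) :
    moment M (u - uH) k = 0 := by
  classical
  have key : M.momentCLM (u - uH) = 0 := by
    refine map_eq_zero_of_core_minimizers_eq_zero (LinearEquiv.refl ℂ (H1P d)) (hV.core hε)
      (α := min a (ε ^ 2 / 2)) (lt_min hV.pos (by positivity))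
      (hV.min_mul_norm_sq_le_form ε) (hV.form_le_mul_norm_sq ε) M.momentCLM
      M.surjective_momentCLM (u - uH) fun j ψ hψ hmin => ?_
    have hadm : ∀ χ : H1P d, Admissible M j χ ↔ M.momentCLM χ = Pi.single j 1 := fun χ => by
      simp only [Admissible, funext_iff, M.momentCLM_apply, Pi.single_apply, eq_comm (a := j)]
    refine hV.form_error_eq_zero hu huH (Submodule.subset_span ⟨j, (hadm ψ).mpr hψ, ?_⟩)
    exact fun χ hχ => hmin χ ((hadm χ).mp hχ)
  rw [← M.momentCLM_apply, key, Pi.zero_apply]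

/-- The Galerkin error `e` satisfies `a(e, e) = a(u, e) = (f, e)`. -/
lemma energyNorm_error_sq_le (hV : IsPotential V a b) (hu : IsWeakSolution ε V f u)
    (huH : IsGalerkinSolution ε V f (globalSpace ε V M) uH) :
    energyNorm ε V (u - uH) ^ 2 ≤ ‖(inner ℂ (u - uH).fn f : ℂ)‖ := by
  have h : form ε V (u - uH) (u - uH) = inner ℂ (u - uH).fn f := by
    rw [hV.form_sub_left, hu, ← form_conj_symm ε V (u - uH) uH,
      hV.form_error_eq_zero hu huH huH.1, map_zero, sub_zero, l2Inner_eq_inner]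
  rw [hV.energyNorm_sq, h]
  exact Complex.re_le_norm _

end IsPotential

/-- A function with vanishing moments pairs only with the part of `v` that finite element functions
do not capture. -/
lemma norm_inner_le_of_moment_eq_zero (hd : 0 < d) (M : Mesh d) {w : H1P d}
    (hw : ∀ k, moment M w k = 0) (v : H1P d) :
    ‖(inner ℂ w.fn v.fn : ℂ)‖ ≤ 2 ^ (d + 1) * M.meshSize * v.gradNorm * ‖w.fn‖ := by
  obtain ⟨c, hc⟩ := M.exists_norm_sub_feFn_le hd v
  have h0 : inner ℂ w.fn (M.memLp_feFn c).toLp = 0 :=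
    inner_eq_zero_symm.mp (M.inner_feFn_eq_zero hw c)
  calc ‖(inner ℂ w.fn v.fn : ℂ)‖ = ‖(inner ℂ w.fn (v.fn - (M.memLp_feFn c).toLp) : ℂ)‖ := by
        rw [inner_sub_right, h0, sub_zero]
    _ ≤ ‖w.fn‖ * ‖v.fn - (M.memLp_feFn c).toLp‖ := norm_inner_le_norm _ _
    _ ≤ ‖w.fn‖ * (2 ^ (d + 1) * M.meshSize * v.gradNorm) := by gcongr
    _ = _ := mul_comm _ _

/-- A Poincaré inequality for functions with vanishing moments. -/
lemma norm_le_of_moment_eq_zero (hd : 0 < d) (M : Mesh d) {w : H1P d}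
    (hw : ∀ k, moment M w k = 0) : ‖w.fn‖ ≤ 2 ^ (d + 1) * M.meshSize * w.gradNorm := by
  have h := norm_inner_le_of_moment_eq_zero hd M hw w
  rw [inner_self_eq_norm_sq_to_K, norm_pow, RCLike.norm_ofReal, abs_norm, sq] at h
  rcases (norm_nonneg w.fn).eq_or_lt with h0 | h0
  · rw [← h0]
    exact mul_nonneg (mul_nonneg (by positivity) (M.meshSize_pos hd).le)
      (gradNorm_nonneg w)
  · exact le_of_mul_le_mul_right h h0

lemma IsPotential.gradNorm_le {V : E d → ℝ} {a b ε : ℝ} (hV : IsPotential V a b) (hε : 0 < ε)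
    (w : H1P d) : w.gradNorm ≤ 2 / ε * energyNorm ε V w := by
  have hE : 0 ≤ energyNorm ε V w := Real.sqrt_nonneg _
  refine le_of_sq_le_sq ?_ (by positivity)
  have h := hV.le_form_self_re ε w
  rw [← hV.energyNorm_sq] at h
  have ha := mul_nonneg hV.pos.le (sq_nonneg ‖w.fn‖)
  rw [mul_pow, div_pow, div_mul_eq_mul_div, le_div_iff₀ (by positivity)]
  nlinarith [sq_nonneg (energyNorm ε V w)]

lemma le_of_sq_le_mul_self {x y : ℝ} (hx : 0 ≤ x) (hy : 0 ≤ y) (h : x ^ 2 ≤ y * x) : x ≤ y := by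
  rcases hx.eq_or_lt with h0 | h0
  · rwa [← h0]
  · exact le_of_mul_le_mul_right (by rwa [← sq]) h0

end OCFEM

end

theorem mainTheorem1 (d : ℕ) (hd : 0 < d) (κ₁ κ₂ c₀ Vmin Vmax : ℝ)
    (hVmin : 0 < Vmin) (hVmax : Vmin ≤ Vmax) (hc₀ : 0 < c₀) :
    ∃ C : ℝ, 0 < C ∧
      ∀ (ε : ℝ) (V : OCFEM.E d → ℝ) (M : OCFEM.Mesh d),
        0 < ε →
        AEMeasurable V (OCFEM.cellMeasure d) →
        (∀ x ∈ OCFEM.cell d, Vmin ≤ V x ∧ V x ≤ Vmax) →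
        M.IsShapeRegular κ₁ →
        M.IsQuasiUniform κ₂ →
        M.meshSize ≤ c₀ * ε →
        ∀ (f : OCFEM.L2 d) (u uH : OCFEM.H1P d),
          OCFEM.IsWeakSolution ε V f u →
          OCFEM.IsGalerkinSolution ε V f (OCFEM.globalSpace ε V M) uH →
          (OCFEM.energyNorm ε V (u - uH) ≤ C * (M.meshSize / ε) * ‖f‖ ∧
            ‖(u - uH).fn‖ ≤ C * (M.meshSize ^ 2 / ε ^ 2) * ‖f‖) ∧
          (∀ F : OCFEM.H1P d, F.fn = f →
            OCFEM.energyNorm ε V (u - uH) ≤ C * (M.meshSize ^ 2 / ε) * F.gradNorm ∧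
            ‖(u - uH).fn‖ ≤ C * (M.meshSize ^ 3 / ε ^ 2) * F.gradNorm) := by
  -- `K` is twice the constant of the finite element approximation; the energy norm controls the
  -- gradient up to `2 / ε`.
  set K : ℝ := 2 ^ (d + 2) with hK
  have hK1 : 1 ≤ K := one_le_pow₀ (by norm_num)
  have hK0 : 0 < K := one_pos.trans_le hK1
  refine ⟨K ^ 3, by positivity, ?_⟩
  intro ε V M hε hVm hVb _ _ _ f u uH hu huH
  have hV : OCFEM.IsPotential V Vmin Vmax := ⟨hVm, hVmin, hVb⟩
  have hmom := hV.moment_error_eq_zero hε hu huH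
  have hH := M.meshSize_pos hd
  have hen := hV.energyNorm_error_sq_le hu huH
  have hgrad := hV.gradNorm_le hε (u - uH)
  have hL2 := OCFEM.norm_le_of_moment_eq_zero hd M hmom
  set H := M.meshSize
  set e := u - uH
  set N := OCFEM.energyNorm ε V e
  have hN : 0 ≤ N := Real.sqrt_nonneg _
  have hK2 : (2 : ℝ) ^ (d + 1) * 2 = K := by rw [hK]; ring
  have hL2N : ‖e.fn‖ ≤ K * (H / ε) * N := by
    calc ‖e.fn‖ ≤ 2 ^ (d + 1) * H * (2 / ε * N) := hL2.trans (by gcongr)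
      _ = 2 ^ (d + 1) * 2 * (H / ε) * N := by ring
      _ = _ := by rw [hK2]
  have hKK : K ≤ K ^ 3 := le_self_pow₀ hK1 (by norm_num)
  have hKK2 : K ^ 2 ≤ K ^ 3 := pow_le_pow_right₀ hK1 (by norm_num)
  refine ⟨?_, fun F hF => ?_⟩
  · have h1 : N ≤ K * (H / ε) * ‖f‖ := by
      refine OCFEM.le_of_sq_le_mul_self hN (by positivity) ?_
      calc N ^ 2 ≤ ‖e.fn‖ * ‖f‖ := hen.trans (norm_inner_le_norm _ _)
        _ ≤ K * (H / ε) * N * ‖f‖ := by gcongr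
        _ = _ := by ring
    refine ⟨h1.trans (by gcongr), ?_⟩
    calc ‖e.fn‖ ≤ K * (H / ε) * (K * (H / ε) * ‖f‖) := hL2N.trans (by gcongr)
      _ = K ^ 2 * (H ^ 2 / ε ^ 2) * ‖f‖ := by ring
      _ ≤ _ := by gcongr
  · subst hF
    have hG := OCFEM.gradNorm_nonneg F
    have h1 : N ≤ K ^ 2 * (H ^ 2 / ε) * F.gradNorm := by
      refine OCFEM.le_of_sq_le_mul_self hN (by positivity) ?_
      calc N ^ 2 ≤ 2 ^ (d + 1) * H * F.gradNorm * ‖e.fn‖ :=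
            hen.trans (OCFEM.norm_inner_le_of_moment_eq_zero hd M hmom F)
        _ ≤ K * H * F.gradNorm * (K * (H / ε) * N) := by
            gcongr
            rw [← hK2]
            exact le_mul_of_one_le_right (by positivity) (by norm_num)
        _ = _ := by ring
    refine ⟨h1.trans (by gcongr), ?_⟩
    calc ‖e.fn‖ ≤ K * (H / ε) * (K ^ 2 * (H ^ 2 / ε) * F.gradNorm) := hL2N.trans (by gcongr)
      _ = _ := by ring
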